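/- Let $H$ be a real or complex Hilbert space. A family $(x_j)$ in $H$ is a frame with constant $c$ if there are numbers $A,B>0$ with $c=(B/A)^{1/2}$ and $$A\|x\|^2\le\sum_j|\langle x,x_j\rangle|^2\le B\|x\|^2\qquad\text{for all }x\in H;$$ it is $n$-dimensional if $\dim H=n$. Two families $(x_j)$ and $(y_j)$ with the same index set are $C$-equivalent if there is an isomorphism $T$ from the closed linear span of $(x_j)$ onto the closed linear span of $(y_j)$ with $Tx_j=y_j$ for all $j$ and $\|T\|\,\|T^{-1}\|\le C$. An orthogonal basis is a family of nonzero pairwise orthogonal vectors (not necessarily normalized) whose closed linear span is the whole space. **Theorem 2.1.** There is a function $h:(0,\infty)\to(0,\infty)$ such that the following holds. Suppose $n\ge 1$ and $(x_j)$ is an $n$-dimensional frame (finite or infinite) with constant $c$. Then for every $\varepsilon>0$ there is a finite set of indices $\sigma$ with $|\sigma|>(1-\varepsilon)n$ such that the system $(x_j)_{j\in\sigma}$ is $C$-equivalent to an orthogonal basis of $\ell_2^\sigma$, where $C=h(\varepsilon)c$. -/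

import Mathlib

/-- The family `x` satisfies the frame inequality
`A ‖v‖² ≤ ∑ⱼ |⟨v, xⱼ⟩|² ≤ B ‖v‖²` for all `v`, with positive numbers `A` and `B`.
(Finiteness of the sum, implicit in the upper bound, is stated as summability.) -/
def HasFrameBounds (𝕜 : Type*) [RCLike 𝕜] {H : Type*} [NormedAddCommGroup H]
    [InnerProductSpace 𝕜 H] {ι : Type*} (x : ι → H) (A B : ℝ) : Prop :=
  0 < A ∧ 0 < B ∧ ∀ v : H,
    Summable (fun j => ‖inner 𝕜 v (x j)‖ ^ 2) ∧
    A * ‖v‖ ^ 2 ≤ ∑' j, ‖inner 𝕜 v (x j)‖ ^ 2 ∧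
    ∑' j, ‖inner 𝕜 v (x j)‖ ^ 2 ≤ B * ‖v‖ ^ 2

/-- The family `x` is a frame with constant `c`, i.e. `c = (B / A)^{1/2}`
for some frame bounds `A`, `B` of `x`. -/
def IsFrameWithConstant (𝕜 : Type*) [RCLike 𝕜] {H : Type*} [NormedAddCommGroup H]
    [InnerProductSpace 𝕜 H] {ι : Type*} (x : ι → H) (c : ℝ) : Prop :=
  ∃ A B : ℝ, HasFrameBounds 𝕜 x A B ∧ c = Real.sqrt (B / A)

/-- The closed linear span `[xⱼ]` of a family of vectors. -/
def closedSpan (𝕜 : Type*) [RCLike 𝕜] {E : Type*} [NormedAddCommGroup E]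
    [NormedSpace 𝕜 E] {ι : Type*} (x : ι → E) : Submodule 𝕜 E :=
  (Submodule.span 𝕜 (Set.range x)).topologicalClosure

theorem mem_closedSpan (𝕜 : Type*) [RCLike 𝕜] {E : Type*} [NormedAddCommGroup E]
    [NormedSpace 𝕜 E] {ι : Type*} (x : ι → E) (j : ι) : x j ∈ closedSpan 𝕜 x :=
  Submodule.le_topologicalClosure _ (Submodule.subset_span (Set.mem_range_self j))

/-- Two families with the same index set are `C`-equivalent: there is an isomorphism
`T : [xⱼ] → [yⱼ]` with `T xⱼ = yⱼ` for all `j` and `‖T‖ ‖T⁻¹‖ ≤ C`. -/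
def IsEquivalentWith (𝕜 : Type*) [RCLike 𝕜] {E F : Type*}
    [NormedAddCommGroup E] [NormedSpace 𝕜 E] [NormedAddCommGroup F] [NormedSpace 𝕜 F]
    {ι : Type*} (C : ℝ) (x : ι → E) (y : ι → F) : Prop :=
  ∃ T : closedSpan 𝕜 x ≃L[𝕜] closedSpan 𝕜 y,
    (∀ j, T ⟨x j, mem_closedSpan 𝕜 x j⟩ = ⟨y j, mem_closedSpan 𝕜 y j⟩) ∧
    ‖(T : closedSpan 𝕜 x →L[𝕜] closedSpan 𝕜 y)‖ *
      ‖(T.symm : closedSpan 𝕜 y →L[𝕜] closedSpan 𝕜 x)‖ ≤ C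

/-- `y` is an orthogonal basis of `K`: nonzero, pairwise orthogonal vectors
(not necessarily of norm one) with closed linear span `K`. -/
def IsOrthogonalBasis (𝕜 : Type*) [RCLike 𝕜] {K : Type*} [NormedAddCommGroup K]
    [InnerProductSpace 𝕜 K] {ι : Type*} (y : ι → K) : Prop :=
  (∀ j, y j ≠ 0) ∧ (∀ i j, i ≠ j → inner 𝕜 (y i) (y j) = 0) ∧ closedSpan 𝕜 y = ⊤

/-! A frame operator `S` lies between `A` and `B`, so applying `S^{-1/2}` costs only the factor `√(B
/ A)` and reduces everything to a Parseval frame `u` (`HasFrameBounds.exists_whitening`). For `u` it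
suffices to find more than `(1 - ε) n` indices whose normalized vectors have Riesz bounds depending
on `ε` alone (`IsParseval.exists_riesz`); the lengths removed by normalizing are put back into the
orthogonal basis.

If `ε n ≥ 2`, two barrier arguments in the style of Batson, Spielman and Srivastava are combined. An
upper barrier picks `N = n M²` frame vectors, with repetitions, whose normalizations have Bessel
bound `β = (M + 1)²` (`IsParseval.exists_bessel`). Any `N` unit vectors in dimension `n` have Bessel
bound at least `N / n = M²`, so this is nearly tight. A lower barrier then gives restricted
invertibility (`exists_shiftedGram_posDef`): from `N` unit vectors with Bessel bound `β` it extracts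
any `k < (1 - b₀) N / β` with Gram matrix bounded below. With `b₀ = 1 / M` and `M` of order `1 / ε`
this count exceeds `(1 - ε) n`. A positive lower Riesz bound excludes repetitions, so the chosen
indices are distinct.

If `ε n < 2`, the dimension is bounded in terms of `ε`, and a greedy choice of `n` vectors with
dimension-dependent bounds suffices (`IsParseval.exists_greedy`). -/

open scoped ComplexOrder Matrix

/-! ### Quadratic forms of inverse matrices: resolvents and Schur complements. -/

theorem Matrix.inv_eq_add_smul_of_posDef {𝕜 κ : Type*} [RCLike 𝕜] [Fintype κ] [DecidableEq κ]
    {M : Matrix κ κ 𝕜} (hM : M.PosDef) {δ : ℝ} (hδ : 0 ≤ δ) :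
    (M + δ • 1).PosDef ∧
    M⁻¹ = (M + δ • 1)⁻¹ + δ • ((M + δ • 1)⁻¹ * (M + δ • 1)⁻¹) +
      δ ^ 2 • ((M + δ • 1)⁻¹ * M⁻¹ * (M + δ • 1)⁻¹) := by
  have hM' : (M + δ • (1 : Matrix κ κ 𝕜)).PosDef :=
    hM.add_posSemidef (Matrix.PosSemidef.one.smul hδ)
  refine ⟨hM', ?_⟩
  set M' := M + δ • (1 : Matrix κ κ 𝕜) with hdef
  have h1 : M * M⁻¹ = 1 := Matrix.mul_nonsing_inv _ ((Matrix.isUnit_iff_isUnit_det _).1 hM.isUnit)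
  have h2 : M⁻¹ * M = 1 := Matrix.nonsing_inv_mul _ ((Matrix.isUnit_iff_isUnit_det _).1 hM.isUnit)
  have h3 : M' * M'⁻¹ = 1 := Matrix.mul_nonsing_inv _ ((Matrix.isUnit_iff_isUnit_det _).1 hM'.isUnit)
  have h4 : M'⁻¹ * M' = 1 := Matrix.nonsing_inv_mul _ ((Matrix.isUnit_iff_isUnit_det _).1 hM'.isUnit)
  -- The resolvent identity in both orders; inserting one into the other leaves a positive
  -- semidefinite remainder, which the barrier estimates drop.
  have e1 : M⁻¹ = M'⁻¹ + δ • (M'⁻¹ * M⁻¹) := by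
    calc M⁻¹ = M'⁻¹ * M' * M⁻¹ := by rw [h4, one_mul]
      _ = M'⁻¹ * (M * M⁻¹) + δ • (M'⁻¹ * M⁻¹) := by
        rw [hdef]; simp [mul_add, add_mul, mul_assoc]
      _ = _ := by rw [h1, mul_one]
  have e2 : M⁻¹ = M'⁻¹ + δ • (M⁻¹ * M'⁻¹) := by
    calc M⁻¹ = M⁻¹ * (M' * M'⁻¹) := by rw [h3, mul_one]
      _ = (M⁻¹ * M) * M'⁻¹ + δ • (M⁻¹ * M'⁻¹) := by
        rw [hdef]; simp [mul_add, add_mul, mul_assoc]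
      _ = _ := by rw [h2, one_mul]
  have e3 : M'⁻¹ * M⁻¹ = M'⁻¹ * M'⁻¹ + δ • (M'⁻¹ * M⁻¹ * M'⁻¹) := by
    conv_lhs => rw [e2]
    simp [mul_add, mul_assoc]
  conv_lhs => rw [e1, e3]
  rw [smul_add, smul_smul, pow_two, add_assoc]

/-- The quadratic form of the inverse of a matrix. -/
noncomputable def invForm {𝕜 κ : Type*} [RCLike 𝕜] [Fintype κ] [DecidableEq κ]
    (M : Matrix κ κ 𝕜) (g : κ → 𝕜) : ℝ := RCLike.re (star g ⬝ᵥ M⁻¹ *ᵥ g)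

theorem Matrix.IsHermitian.star_dotProduct_mulVec {𝕜 κ : Type*} [RCLike 𝕜] [Fintype κ]
    {M : Matrix κ κ 𝕜} (hM : M.IsHermitian) (x y : κ → 𝕜) :
    star (M *ᵥ x) ⬝ᵥ y = star x ⬝ᵥ M *ᵥ y := by
  rw [Matrix.star_mulVec, hM.eq, Matrix.dotProduct_mulVec]

/-- Quantitative monotonicity: shifting by `δ` lowers the form by at least `δ` times the squared
norm of the new solution vector. This gain pays for the next vector in the lower barrier. -/
theorem invForm_add_smul_le {𝕜 κ : Type*} [RCLike 𝕜] [Fintype κ] [DecidableEq κ]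
    {M : Matrix κ κ 𝕜} (hM : M.PosDef) {δ : ℝ} (hδ : 0 ≤ δ) (g : κ → 𝕜) :
    invForm (M + δ • 1) g + δ * ∑ a, ‖((M + δ • 1)⁻¹ *ᵥ g) a‖ ^ 2 ≤ invForm M g := by
  obtain ⟨hM', he⟩ := Matrix.inv_eq_add_smul_of_posDef hM hδ
  set R' := (M + δ • (1 : Matrix κ κ 𝕜))⁻¹ with hR'
  have hH : R'.IsHermitian := hM'.inv.isHermitian
  have h0 : 0 ≤ RCLike.re (star (R' *ᵥ g) ⬝ᵥ M⁻¹ *ᵥ (R' *ᵥ g)) :=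
    hM.inv.posSemidef.re_dotProduct_nonneg _
  have h1 : star g ⬝ᵥ (R' * R') *ᵥ g = ((∑ a, ‖(R' *ᵥ g) a‖ ^ 2 : ℝ) : 𝕜) := by
    rw [← Matrix.mulVec_mulVec, ← hH.star_dotProduct_mulVec]
    simp [dotProduct, RCLike.conj_mul]
  have h2 : star g ⬝ᵥ (R' * M⁻¹ * R') *ᵥ g = star (R' *ᵥ g) ⬝ᵥ M⁻¹ *ᵥ (R' *ᵥ g) := by
    rw [hH.star_dotProduct_mulVec, Matrix.mulVec_mulVec, Matrix.mulVec_mulVec, mul_assoc]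
  unfold invForm
  rw [he, ← hR', Matrix.add_mulVec, Matrix.add_mulVec, Matrix.smul_mulVec, Matrix.smul_mulVec,
    dotProduct_add, dotProduct_add, dotProduct_smul, dotProduct_smul, h1, h2]
  simp only [map_add, RCLike.smul_re, RCLike.ofReal_re]
  nlinarith [mul_nonneg (sq_nonneg δ) h0]

theorem invForm_eq_of_mulVec_eq {𝕜 κ : Type*} [RCLike 𝕜] [Fintype κ] [DecidableEq κ]
    {M : Matrix κ κ 𝕜} (hM : M.PosDef) {g z : κ → 𝕜} (h : M *ᵥ z = g) :
    invForm M g = RCLike.re (star g ⬝ᵥ z) := by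
  have h2 : M⁻¹ * M = 1 := Matrix.nonsing_inv_mul _ ((Matrix.isUnit_iff_isUnit_det _).1 hM.isUnit)
  unfold invForm
  rw [← h, Matrix.mulVec_mulVec, h2, Matrix.one_mulVec]

theorem mulVec_inv_mulVec {𝕜 κ : Type*} [RCLike 𝕜] [Fintype κ] [DecidableEq κ]
    {M : Matrix κ κ 𝕜} (hM : M.PosDef) (g : κ → 𝕜) : M *ᵥ (M⁻¹ *ᵥ g) = g := by
  rw [Matrix.mulVec_mulVec, Matrix.mul_nonsing_inv _ ((Matrix.isUnit_iff_isUnit_det _).1 hM.isUnit),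
    Matrix.one_mulVec]

theorem ofReal_invForm {𝕜 κ : Type*} [RCLike 𝕜] [Fintype κ] [DecidableEq κ]
    {M : Matrix κ κ 𝕜} (hM : M.PosDef) (g : κ → 𝕜) :
    ((invForm M g : ℝ) : 𝕜) = star g ⬝ᵥ M⁻¹ *ᵥ g := by
  have := hM.inv.posSemidef.dotProduct_mulVec_nonneg g
  exact (RCLike.nonneg_iff_exists_ofReal.1 this).elim fun r hr => by
    unfold invForm; rw [← hr.2]; simp

/-- The bordered matrix of `M` by a vector `g` and a real corner `d`. -/
def bordered {𝕜 κ : Type*} [RCLike 𝕜] (M : Matrix κ κ 𝕜) (g : κ → 𝕜) (d : ℝ) :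
    Matrix (κ ⊕ Unit) (κ ⊕ Unit) 𝕜 :=
  Matrix.fromBlocks M (Matrix.of fun a _ => g a) (Matrix.of fun _ a => star (g a))
    (Matrix.of fun _ _ => (d : 𝕜))

theorem bordered_mulVec {𝕜 κ : Type*} [RCLike 𝕜] [Fintype κ] (M : Matrix κ κ 𝕜) (g : κ → 𝕜) (d : ℝ)
    (z : κ → 𝕜) (c : 𝕜) :
    bordered M g d *ᵥ (Sum.elim z fun _ => c) =
      Sum.elim (M *ᵥ z + c • g) (fun _ => star g ⬝ᵥ z + d * c) := by
  unfold bordered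
  rw [Matrix.fromBlocks_mulVec]
  ext i
  rcases i with i | i
  · simp [Matrix.mulVec, dotProduct, mul_comm]
  · simp [Matrix.mulVec, dotProduct]

theorem bordered_posDef {𝕜 κ : Type*} [RCLike 𝕜] [Fintype κ] [DecidableEq κ]
    {M : Matrix κ κ 𝕜} (hM : M.PosDef) {g : κ → 𝕜} {d : ℝ} (hs : invForm M g < d) :
    (bordered M g d).PosDef := by
  refine Matrix.PosDef.of_dotProduct_mulVec_pos ?_ ?_
  · unfold bordered
    refine Matrix.IsHermitian.fromBlocks hM.isHermitian ?_ ?_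
    · ext i j; simp
    · ext i j; simp
  intro x hx
  set y : κ → 𝕜 := fun a => x (Sum.inl a) with hy
  set c : 𝕜 := x (Sum.inr ()) with hc
  have hxe : x = Sum.elim y (fun _ => c) := by ext i; rcases i with i | i <;> rfl
  set z := M⁻¹ *ᵥ g with hz
  have hMz : M *ᵥ z = g := mulVec_inv_mulVec hM g
  have hgz : star g ⬝ᵥ z = ((invForm M g : ℝ) : 𝕜) := (ofReal_invForm hM g).symm
  have hzg : star z ⬝ᵥ g = ((invForm M g : ℝ) : 𝕜) := by
    rw [← hgz]; conv_lhs => rw [← hMz]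
    rw [← hM.isHermitian.star_dotProduct_mulVec, hMz]
  -- Completing the square: the Schur complement `d - invForm M g` is the coefficient of the new
  -- coordinate.
  have key : star x ⬝ᵥ bordered M g d *ᵥ x =
      star (y + c • z) ⬝ᵥ M *ᵥ (y + c • z) + ((d - invForm M g : ℝ) : 𝕜) * (star c * c) := by
    rw [hxe, bordered_mulVec]
    have e1 : star (Sum.elim y fun _ : Unit => c) ⬝ᵥ
        (Sum.elim (M *ᵥ y + c • g) fun _ : Unit => star g ⬝ᵥ y + d * c) =
        star y ⬝ᵥ (M *ᵥ y + c • g) + star c * (star g ⬝ᵥ y + d * c) := by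
      simp [dotProduct]
    rw [e1, Matrix.mulVec_add, Matrix.mulVec_smul, hMz, star_add, star_smul, add_dotProduct,
      smul_dotProduct, dotProduct_add, dotProduct_add, dotProduct_smul,
      dotProduct_smul, hzg, ← hM.isHermitian.star_dotProduct_mulVec z, hMz]
    simp only [smul_eq_mul]
    push_cast
    ring
  rw [key]
  have hsc : 0 ≤ star c * c := star_mul_self_nonneg c
  have hd : (0 : 𝕜) < ((d - invForm M g : ℝ) : 𝕜) := by
    rw [RCLike.ofReal_pos]; linarith
  by_cases hc0 : c = 0
  · have hy0 : y ≠ 0 := by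
      rintro h0; apply hx; rw [hxe, h0, hc0]; ext i; rcases i with i | i <;> rfl
    rw [hc0]; simpa using hM.dotProduct_mulVec_pos hy0
  · have h1 : 0 < star c * c := lt_of_le_of_ne hsc (by
      intro h; simp [hc0] at h)
    exact add_pos_of_nonneg_of_pos (hM.posSemidef.dotProduct_mulVec_nonneg _) (mul_pos hd h1)

theorem invForm_bordered {𝕜 κ : Type*} [RCLike 𝕜] [Fintype κ] [DecidableEq κ]
    {M : Matrix κ κ 𝕜} (hM : M.PosDef) {g : κ → 𝕜} {d : ℝ} (hs : invForm M g < d)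
    (h : κ → 𝕜) (t : 𝕜) :
    invForm (bordered M g d) (Sum.elim h fun _ => t) =
      invForm M h + ‖t - star g ⬝ᵥ M⁻¹ *ᵥ h‖ ^ 2 / (d - invForm M g) := by
  set s : ℝ := d - invForm M g with hsdef
  have hs0 : (s : 𝕜) ≠ 0 := by
    rw [Ne, RCLike.ofReal_eq_zero]; exact (sub_pos.2 hs).ne'
  set z := M⁻¹ *ᵥ h with hz
  set p := M⁻¹ *ᵥ g with hp
  have hMz : M *ᵥ z = h := mulVec_inv_mulVec hM h
  have hMp : M *ᵥ p = g := mulVec_inv_mulVec hM g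
  have hgp : star g ⬝ᵥ p = ((invForm M g : ℝ) : 𝕜) := (ofReal_invForm hM g).symm
  -- Block elimination: `τ` is the last coordinate of the solution of the bordered system with
  -- right-hand side `(h, t)`.
  set τ : 𝕜 := (t - star g ⬝ᵥ z) / s with hτ
  have hsol : bordered M g d *ᵥ (Sum.elim (z - τ • p) fun _ => τ) = Sum.elim h fun _ => t := by
    rw [bordered_mulVec, Matrix.mulVec_sub, Matrix.mulVec_smul, hMz, hMp, sub_add_cancel,
      dotProduct_sub, dotProduct_smul, hgp]
    congr 1
    funext _
    have : τ * s = t - star g ⬝ᵥ z := by rw [hτ]; field_simp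
    rw [hsdef] at this
    push_cast at this
    simp only [smul_eq_mul]
    linear_combination this
  rw [invForm_eq_of_mulVec_eq (bordered_posDef hM hs) hsol]
  have hhp : star h ⬝ᵥ p = star (star g ⬝ᵥ z) := by
    rw [← hMz, hM.isHermitian.star_dotProduct_mulVec, hMp, ← Matrix.star_dotProduct_star]
    simp [dotProduct_comm]
  have e1 : star (Sum.elim h fun _ : Unit => t) ⬝ᵥ (Sum.elim (z - τ • p) fun _ : Unit => τ) =
      star h ⬝ᵥ z + τ * star (t - star g ⬝ᵥ z) := by
    have : star (Sum.elim h fun _ : Unit => t) ⬝ᵥ (Sum.elim (z - τ • p) fun _ : Unit => τ) =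
      star h ⬝ᵥ (z - τ • p) + star t * τ := by simp [dotProduct]
    rw [this, dotProduct_sub, dotProduct_smul, hhp, star_sub, smul_eq_mul]; ring
  rw [e1, map_add]
  congr 1
  have : τ * star (t - star g ⬝ᵥ z) = ((‖t - star g ⬝ᵥ z‖ ^ 2 / s : ℝ) : 𝕜) := by
    rw [hτ, div_mul_eq_mul_div]
    push_cast
    congr 1
    exact RCLike.mul_conj _
  rw [this, RCLike.ofReal_re]

/-! ### Parseval frames and the upper barrier. -/

/-- The family `u` of coordinate vectors is a Parseval frame: `∑ⱼ uⱼ uⱼ* = 1`. -/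
def IsParseval {𝕜 ι m : Type*} [RCLike 𝕜] [DecidableEq m] (u : ι → EuclideanSpace 𝕜 m) : Prop :=
  ∀ k l, HasSum (fun j => u j k * star (u j l)) (if k = l then 1 else 0)

theorem IsParseval.hasSum_form {𝕜 ι m : Type*} [RCLike 𝕜] [Fintype m] [DecidableEq m]
    {u : ι → EuclideanSpace 𝕜 m} (hu : IsParseval u) (M : Matrix m m 𝕜) :
    HasSum (fun j => RCLike.re (star (u j).ofLp ⬝ᵥ M *ᵥ (u j).ofLp)) (RCLike.re M.trace) := by
  have h : HasSum (fun j => ∑ k, ∑ l, M k l * (u j l * star (u j k)))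
      (∑ k, ∑ l, M k l * (if l = k then 1 else 0)) :=
    hasSum_sum fun k _ => hasSum_sum fun l _ => (hu l k).mul_left _
  have h2 := RCLike.hasSum_re 𝕜 h
  convert h2 using 1
  · funext j
    congr 1
    simp only [dotProduct, Matrix.mulVec, Finset.mul_sum]
    exact Finset.sum_congr rfl fun k _ => Finset.sum_congr rfl fun l _ => by
      simp only [Pi.star_apply]; ring
  · congr 1
    simp [Matrix.trace]

/-- Averaging: the forms sum to the trace of `M`, while the `‖u j‖ ^ 2` sum to the dimension. Zero
vectors give equality, so a failure at every nonzero vector would make the comparison of sums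
strict. -/
theorem IsParseval.exists_form_le {𝕜 ι m : Type*} [RCLike 𝕜] [Fintype m] [DecidableEq m] [Nonempty m]
    {u : ι → EuclideanSpace 𝕜 m} (hu : IsParseval u) {M : Matrix m m 𝕜}
    (hM : RCLike.re M.trace ≤ Fintype.card m) :
    ∃ j, u j ≠ 0 ∧ RCLike.re (star (u j).ofLp ⬝ᵥ M *ᵥ (u j).ofLp) ≤ ‖u j‖ ^ 2 := by
  by_contra! hcon
  have hs : HasSum (fun j => ‖u j‖ ^ 2) (Fintype.card m : ℝ) := by
    have := hu.hasSum_form (1 : Matrix m m 𝕜)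
    convert this using 1
    · funext j
      rw [EuclideanSpace.norm_sq_eq]
      simp [dotProduct, RCLike.conj_mul]
    · simp
  have hle : ∀ j, ‖u j‖ ^ 2 ≤ RCLike.re (star (u j).ofLp ⬝ᵥ M *ᵥ (u j).ofLp) := fun j => by
    by_cases h : u j = 0
    · simp [h]
    · exact (hcon j h).le
  obtain ⟨j, hj⟩ : ∃ j, u j ≠ 0 := by
    by_contra! h0
    have : HasSum (fun j => ‖u j‖ ^ 2) 0 := by
      convert hasSum_zero using 2 with j; simp [h0 j]
    have := hs.unique this
    simp at this
  exact absurd hM (not_le.2 (hasSum_lt hle (hcon j hj) hs (hu.hasSum_form M)))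

theorem Matrix.IsHermitian.mulVec_vecMulVec {𝕜 m : Type*} [RCLike 𝕜] [Fintype m]
    {R : Matrix m m 𝕜} (hR : R.IsHermitian) (v : m → 𝕜) :
    Matrix.vecMulVec (R *ᵥ v) (star (R *ᵥ v)) = R * Matrix.vecMulVec v (star v) * R := by
  rw [Matrix.star_mulVec, hR.eq, Matrix.mul_vecMulVec, Matrix.vecMulVec_mul]

/-- Rank one downdate of a positive definite matrix. -/
theorem Matrix.PosDef.sub_vecMulVec {𝕜 m : Type*} [RCLike 𝕜] [Fintype m] [DecidableEq m]
    {M : Matrix m m 𝕜} (hM : M.PosDef) {v : m → 𝕜} {a : ℝ} (h : invForm M v < a) :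
    (M - a⁻¹ • Matrix.vecMulVec v (star v)).PosDef ∧
    RCLike.re (M - a⁻¹ • Matrix.vecMulVec v (star v))⁻¹.trace =
      RCLike.re M⁻¹.trace + (∑ k, ‖(M⁻¹ *ᵥ v) k‖ ^ 2) / (a - invForm M v) := by
  have hc0 : 0 ≤ invForm M v := hM.inv.posSemidef.re_dotProduct_nonneg _
  set c := invForm M v with hc
  have hR := hM.inv
  set R := M⁻¹ with hRdef
  have h1 : M * R = 1 := Matrix.mul_nonsing_inv _ ((Matrix.isUnit_iff_isUnit_det _).1 hM.isUnit)
  have hac : 0 < a - c := sub_pos.2 h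
  have ha : 0 < a := by linarith
  set V := Matrix.vecMulVec v (star v) with hV
  -- Sherman–Morrison: since `V` has rank one, `V R V` is a multiple of `V`, and the inverse has the
  -- closed form `N`.
  have hVRV : V * R * V = c • V := by
    rw [hV, mul_assoc, Matrix.mul_vecMulVec, Matrix.vecMulVec_mul_vecMulVec, hRdef,
      ← ofReal_invForm hM, ← hc]
    ext i j; simp [Matrix.vecMulVec_apply, Algebra.smul_def]; try ring
  set N := R + (a - c)⁻¹ • (R * V * R) with hN
  have hmul : (M - a⁻¹ • V) * N = 1 := by
    have e : (M - a⁻¹ • V) * N = M * R + (a - c)⁻¹ • ((M * R) * V * R) - a⁻¹ • (V * R)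
        - (a⁻¹ * (a - c)⁻¹) • ((V * R * V) * R) := by
      rw [hN]
      simp only [sub_mul, mul_add, Matrix.mul_smul, Matrix.smul_mul, smul_smul, mul_assoc]
      rw [mul_comm (a - c)⁻¹]
      abel
    rw [e, h1, hVRV, one_mul, Matrix.smul_mul, smul_smul, add_sub_assoc, ← sub_smul, add_sub_assoc,
      ← sub_smul]
    have : (a - c)⁻¹ - a⁻¹ - a⁻¹ * (a - c)⁻¹ * c = 0 := by
      field_simp; ring
    rw [this, zero_smul, add_zero]
  have hRVR : (R * V * R).PosSemidef := by
    rw [hV, ← hR.isHermitian.mulVec_vecMulVec]; exact Matrix.posSemidef_vecMulVec_self_star _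
  have hNpos : N.PosDef := hR.add_posSemidef (hRVR.smul (inv_nonneg.2 hac.le))
  have hinv : (M - a⁻¹ • V)⁻¹ = N := Matrix.inv_eq_right_inv hmul
  refine ⟨?_, ?_⟩
  · have : (M - a⁻¹ • V) = N⁻¹ := (Matrix.inv_eq_left_inv hmul).symm
    rw [this]; exact hNpos.inv
  · rw [hinv, hN, hV, ← hR.isHermitian.mulVec_vecMulVec, Matrix.trace_add, Matrix.trace_smul,
      Matrix.trace_vecMulVec, map_add, RCLike.smul_re, div_eq_inv_mul]
    congr 2
    simp [dotProduct, RCLike.mul_conj]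

theorem trace_inv_add_smul_le {𝕜 m : Type*} [RCLike 𝕜] [Fintype m] [DecidableEq m]
    {M : Matrix m m 𝕜} (hM : M.PosDef) {δ : ℝ} (hδ : 0 ≤ δ) :
    RCLike.re (M + δ • 1)⁻¹.trace + δ * RCLike.re ((M + δ • 1)⁻¹ * (M + δ • 1)⁻¹).trace ≤
      RCLike.re M⁻¹.trace := by
  obtain ⟨hM', he⟩ := Matrix.inv_eq_add_smul_of_posDef hM hδ
  conv_rhs => rw [he]
  have hp := hM.inv.posSemidef.mul_mul_conjTranspose_same (M + δ • (1 : Matrix m m 𝕜))⁻¹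
  rw [hM'.inv.isHermitian.eq] at hp
  have h0 := (RCLike.nonneg_iff.1 hp.trace_nonneg).1
  simp only [Matrix.trace_add, Matrix.trace_smul, map_add, RCLike.smul_re]
  nlinarith [mul_nonneg (sq_nonneg δ) h0]

/-- Raising the barrier by `δ` lowers the potential `tr M⁻¹` by `D ≥ δ tr R²`; subtracting a
normalized rank-one term raises it again. Averaging `D⁻¹ R² + R`, of trace at most `δ⁻¹ + φ`, finds
a vector whose increase is at most `D`. -/
theorem IsParseval.exists_upper_barrier_step {𝕜 ι m : Type*} [RCLike 𝕜] [Fintype m] [DecidableEq m]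
    [Nonempty m] {u : ι → EuclideanSpace 𝕜 m} (hu : IsParseval u) {M : Matrix m m 𝕜} (hM : M.PosDef)
    {δ φ : ℝ} (hδ : 0 < δ) (hφ : RCLike.re M⁻¹.trace ≤ φ) (hδφ : δ⁻¹ + φ ≤ Fintype.card m) :
    ∃ j, u j ≠ 0 ∧
      (M + δ • 1 - (‖u j‖ ^ 2)⁻¹ • Matrix.vecMulVec (u j).ofLp (star (u j).ofLp)).PosDef ∧
      RCLike.re (M + δ • 1 -
        (‖u j‖ ^ 2)⁻¹ • Matrix.vecMulVec (u j).ofLp (star (u j).ofLp))⁻¹.trace ≤ φ := by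
  have hM' := (Matrix.inv_eq_add_smul_of_posDef hM hδ.le).1
  have hD := trace_inv_add_smul_le hM hδ.le
  set M' := M + δ • (1 : Matrix m m 𝕜) with hM'def
  set R := M'⁻¹ with hR
  have hRpos : R.PosDef := hM'.inv
  have hRRpos : (R * R).PosDef := by
    have := Matrix.PosDef.conjTranspose_mul_self R (Matrix.mulVec_injective_of_isUnit hRpos.isUnit)
    rwa [hRpos.isHermitian.eq] at this
  have hRR0 : 0 < RCLike.re (R * R).trace := (RCLike.pos_iff.1 hRRpos.trace_pos).1
  set D := RCLike.re M⁻¹.trace - RCLike.re R.trace with hDdef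
  have hDpos : 0 < D := by nlinarith [mul_pos hδ hRR0]
  have htr : RCLike.re (D⁻¹ • (R * R) + R).trace ≤ Fintype.card m := by
    rw [Matrix.trace_add, Matrix.trace_smul, map_add, RCLike.smul_re]
    have h1 : D⁻¹ * RCLike.re (R * R).trace ≤ δ⁻¹ := by
      rw [inv_mul_le_iff₀ hDpos, le_mul_inv_iff₀ hδ]; linarith
    linarith
  obtain ⟨j, hj0, hj⟩ := hu.exists_form_le htr
  have hv0 : (u j).ofLp ≠ 0 := fun h => hj0 (by ext k; exact congrFun h k)
  have he : star (u j).ofLp ⬝ᵥ (R * R) *ᵥ (u j).ofLp =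
      ((∑ a, ‖(R *ᵥ (u j).ofLp) a‖ ^ 2 : ℝ) : 𝕜) := by
    rw [← Matrix.mulVec_mulVec, ← hRpos.isHermitian.star_dotProduct_mulVec]
    simp [dotProduct, RCLike.conj_mul]
  set e := ∑ a, ‖(R *ᵥ (u j).ofLp) a‖ ^ 2 with hedef
  have hepos : 0 < e := by
    have := hRRpos.dotProduct_mulVec_pos hv0
    rw [he] at this; exact RCLike.ofReal_pos.1 this
  rw [Matrix.add_mulVec, Matrix.smul_mulVec, dotProduct_add, dotProduct_smul, he, map_add,
    RCLike.smul_re, RCLike.ofReal_re] at hj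
  change D⁻¹ * e + invForm M' (u j).ofLp ≤ _ at hj
  have hlt : invForm M' (u j).ofLp < ‖u j‖ ^ 2 := by
    have := mul_pos (inv_pos.2 hDpos) hepos
    linarith
  obtain ⟨hp, ht⟩ := hM'.sub_vecMulVec hlt
  refine ⟨j, hj0, hp, ?_⟩
  rw [ht, ← hR, ← hedef]
  have : e / (‖u j‖ ^ 2 - invForm M' (u j).ofLp) ≤ D := by
    rw [div_le_iff₀ (sub_pos.2 hlt), ← inv_mul_le_iff₀ hDpos]; linarith
  linarith

/-- The potential starts at `card m / β₀` and never grows, so the same increment `δ` works at every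
step. -/
theorem IsParseval.exists_upper_barrier {𝕜 ι m : Type*} [RCLike 𝕜] [Fintype m] [DecidableEq m]
    [Nonempty m] {u : ι → EuclideanSpace 𝕜 m} (hu : IsParseval u) {δ β₀ : ℝ} (hδ : 0 < δ)
    (hβ₀ : 0 < β₀) (h : δ⁻¹ + Fintype.card m / β₀ ≤ Fintype.card m) (N : ℕ) :
    ∃ J : Fin N → ι, (∀ i, u (J i) ≠ 0) ∧
      ((β₀ + N * δ) • (1 : Matrix m m 𝕜) - ∑ i, (‖u (J i)‖ ^ 2)⁻¹ •
        Matrix.vecMulVec (u (J i)).ofLp (star (u (J i)).ofLp)).PosDef ∧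
      RCLike.re ((β₀ + N * δ) • (1 : Matrix m m 𝕜) - ∑ i, (‖u (J i)‖ ^ 2)⁻¹ •
        Matrix.vecMulVec (u (J i)).ofLp (star (u (J i)).ofLp))⁻¹.trace ≤ Fintype.card m / β₀ := by
  induction N with
  | zero =>
    refine ⟨Fin.elim0, fun i => i.elim0, ?_, ?_⟩
    · simpa using Matrix.PosDef.one.smul hβ₀
    · have : (β₀ • (1 : Matrix m m 𝕜))⁻¹ = β₀⁻¹ • 1 := by
        refine Matrix.inv_eq_right_inv ?_
        rw [Matrix.smul_mul, Matrix.mul_smul, smul_smul, mul_inv_cancel₀ hβ₀.ne', one_smul, one_mul]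
      simp [this, RCLike.smul_re, div_eq_inv_mul]
  | succ N ih =>
    obtain ⟨J, hJ0, hJ, hJt⟩ := ih
    obtain ⟨j, hj0, hj, hjt⟩ := hu.exists_upper_barrier_step hJ hδ hJt h
    refine ⟨Fin.snoc J j, ?_, ?_⟩
    · intro i
      refine Fin.lastCases ?_ (fun i => ?_) i
      · simpa using hj0
      · simpa using hJ0 i
    · rw [Fin.sum_univ_castSucc]
      simp only [Fin.snoc_castSucc, Fin.snoc_last]
      have : (β₀ + ((N + 1 : ℕ) : ℝ) * δ) • (1 : Matrix m m 𝕜) = (β₀ + N * δ) • 1 + δ • 1 := by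
        rw [← add_smul]; push_cast; ring_nf
      rw [this, sub_add_eq_sub_sub, add_sub_right_comm]
      exact ⟨hj, hjt⟩

/-- A Parseval frame contains arbitrarily many (possibly repeated) vectors whose normalizations form
an almost tight Bessel system. -/
theorem IsParseval.exists_bessel {𝕜 ι m : Type*} [RCLike 𝕜] [Fintype m] [DecidableEq m]
    [Nonempty m] {u : ι → EuclideanSpace 𝕜 m} (hu : IsParseval u) {δ β₀ : ℝ} (hδ : 0 < δ)
    (hβ₀ : 0 < β₀) (h : δ⁻¹ + Fintype.card m / β₀ ≤ Fintype.card m) (N : ℕ) :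
    ∃ J : Fin N → ι, (∀ i, u (J i) ≠ 0) ∧ ∀ x : EuclideanSpace 𝕜 m,
      ∑ i, ‖inner 𝕜 x (((‖u (J i)‖ : 𝕜)⁻¹) • u (J i))‖ ^ 2 ≤ (β₀ + N * δ) * ‖x‖ ^ 2 := by
  obtain ⟨J, hJ0, hJ, -⟩ := hu.exists_upper_barrier hδ hβ₀ h N
  refine ⟨J, hJ0, fun x => ?_⟩
  have := hJ.posSemidef.re_dotProduct_nonneg x.ofLp
  rw [Matrix.sub_mulVec, dotProduct_sub, map_sub, Matrix.smul_mulVec, Matrix.one_mulVec,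
    dotProduct_smul, RCLike.smul_re, Matrix.sum_mulVec, dotProduct_sum, map_sum] at this
  have hx : RCLike.re (star x.ofLp ⬝ᵥ x.ofLp) = ‖x‖ ^ 2 := by
    rw [EuclideanSpace.norm_sq_eq]
    simp [dotProduct, RCLike.conj_mul]
  rw [hx] at this
  refine le_trans (le_of_eq (Finset.sum_congr rfl fun i _ => ?_)) (sub_nonneg.1 this)
  rw [Matrix.smul_mulVec, dotProduct_smul, RCLike.smul_re, Matrix.vecMulVec_mulVec,
    inner_smul_right, norm_mul, mul_pow]
  congr 1
  · simp
  · rw [EuclideanSpace.inner_eq_star_dotProduct, dotProduct_smul, MulOpposite.smul_eq_mul_unop,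
      MulOpposite.unop_op]
    have h2 : star (u (J i)).ofLp ⬝ᵥ x.ofLp = star (star x.ofLp ⬝ᵥ (u (J i)).ofLp) := by
      rw [Matrix.star_dotProduct]
    rw [h2, dotProduct_comm (u (J i)).ofLp]
    have h3 := RCLike.mul_conj (star x.ofLp ⬝ᵥ (u (J i)).ofLp)
    rw [starRingEnd_apply] at h3
    rw [h3, ← RCLike.ofReal_pow, RCLike.ofReal_re]

/-! ### The lower barrier: restricted invertibility through Gram matrices. -/

section LowerBarrier

variable {𝕜 E α κ : Type*} [RCLike 𝕜] [NormedAddCommGroup E] [InnerProductSpace 𝕜 E]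

/-- The Gram matrix of the family `w ∘ f`, shifted by `-b`. -/
noncomputable def shiftedGram (𝕜 : Type*) [RCLike 𝕜] [InnerProductSpace 𝕜 E] [DecidableEq κ]
    (w : α → E) (f : κ → α) (b : ℝ) : Matrix κ κ 𝕜 :=
  Matrix.gram 𝕜 (w ∘ f) - b • 1

/-- The vector of inner products of `x` with the family `w ∘ f`. -/
def innerVec (𝕜 : Type*) [RCLike 𝕜] [InnerProductSpace 𝕜 E] (w : α → E) (f : κ → α) (x : E) :
    κ → 𝕜 := fun a => inner 𝕜 (w (f a)) x

theorem shiftedGram_add_smul [DecidableEq κ] (w : α → E) (f : κ → α) (b b' : ℝ) :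
    shiftedGram 𝕜 w f b' = shiftedGram 𝕜 w f b + (b - b') • 1 := by
  unfold shiftedGram
  rw [sub_smul]; abel

theorem shiftedGram_sumElim [DecidableEq κ] {w : α → E} (hw : ∀ i, ‖w i‖ = 1) (f : κ → α) (l : α)
    (b : ℝ) : shiftedGram 𝕜 w (Sum.elim f fun _ : Unit => l) b =
      bordered (shiftedGram 𝕜 w f b) (innerVec 𝕜 w f (w l)) (1 - b) := by
  ext i j
  rcases i with i | i <;> rcases j with j | j
  · simp [shiftedGram, bordered, Matrix.gram, Matrix.one_apply]
  · simp [shiftedGram, bordered, Matrix.gram, innerVec]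
  · simp [shiftedGram, bordered, Matrix.gram, innerVec]
  · simp [shiftedGram, bordered, Matrix.gram, inner_self_eq_norm_sq_to_K, hw, Algebra.smul_def]

theorem innerVec_sumElim (w : α → E) (f : κ → α) (l : α) (x : E) :
    innerVec 𝕜 w (Sum.elim f fun _ : Unit => l) x =
      Sum.elim (innerVec 𝕜 w f x) fun _ => inner 𝕜 (w l) x := by
  ext i; rcases i with i | i <;> rfl

variable [Fintype κ] [DecidableEq κ]

/-- `x` minus the combination of `w ∘ f` with coefficients `(G - b)⁻¹ g`. -/
noncomputable def barrierResidual (𝕜 : Type*) [RCLike 𝕜] [InnerProductSpace 𝕜 E]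
    (w : α → E) (f : κ → α) (b : ℝ) (x : E) : E :=
  x - ∑ a, ((shiftedGram 𝕜 w f b)⁻¹ *ᵥ innerVec 𝕜 w f x) a • w (f a)

theorem inner_barrierResidual {w : α → E} {f : κ → α} {b : ℝ}
    (hM : (shiftedGram 𝕜 w f b).PosDef) (x y : E) :
    inner 𝕜 (barrierResidual 𝕜 w f b x) y = inner 𝕜 x y -
      star (innerVec 𝕜 w f x) ⬝ᵥ (shiftedGram 𝕜 w f b)⁻¹ *ᵥ innerVec 𝕜 w f y := by
  unfold barrierResidual
  rw [inner_sub_left, sum_inner, ← hM.inv.isHermitian.star_dotProduct_mulVec]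
  congr 1
  simp [dotProduct, inner_smul_left, innerVec]

theorem norm_barrierResidual_sq {w : α → E} {f : κ → α} {b : ℝ}
    (hM : (shiftedGram 𝕜 w f b).PosDef) (x : E) :
    ‖barrierResidual 𝕜 w f b x‖ ^ 2 = ‖x‖ ^ 2 - invForm (shiftedGram 𝕜 w f b) (innerVec 𝕜 w f x) +
      b * ∑ a, ‖((shiftedGram 𝕜 w f b)⁻¹ *ᵥ innerVec 𝕜 w f x) a‖ ^ 2 := by
  set M := shiftedGram 𝕜 w f b with hMdef
  set g := innerVec 𝕜 w f x with hg
  set z := M⁻¹ *ᵥ g with hz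
  have hMz : M *ᵥ z = g := mulVec_inv_mulVec hM g
  have h1 : inner 𝕜 x (∑ a, z a • w (f a)) = ((invForm M g : ℝ) : 𝕜) := by
    rw [ofReal_invForm hM, inner_sum]
    simp [dotProduct, inner_smul_right, hz, hg, innerVec, mul_comm]
  have hzz : star z ⬝ᵥ z = ((∑ a, ‖z a‖ ^ 2 : ℝ) : 𝕜) := by
    simp [dotProduct, RCLike.conj_mul]
  -- The Gram matrix is the shifted matrix plus `b`, and the shifted matrix sends `z` to `g`; the
  -- shift accounts for the term `b * ∑ ‖z a‖ ^ 2`.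
  have h2 : ‖∑ a, z a • w (f a)‖ ^ 2 = invForm M g + b * ∑ a, ‖z a‖ ^ 2 := by
    rw [← inner_self_eq_norm_sq (𝕜 := 𝕜)]
    have := Matrix.star_dotProduct_gram_mulVec (𝕜 := 𝕜) (w ∘ f) z z
    have hgram : Matrix.gram 𝕜 (w ∘ f) = M + b • 1 := by rw [hMdef, shiftedGram]; abel
    rw [hgram, Matrix.add_mulVec, hMz, Matrix.smul_mulVec, Matrix.one_mulVec, dotProduct_add,
      dotProduct_smul, hzz] at this
    simp only [Function.comp] at this
    rw [← this, map_add, RCLike.smul_re, RCLike.ofReal_re]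
    congr 1
    rw [← hMz, ← hM.isHermitian.star_dotProduct_mulVec, hMz]
    rfl
  have h3 : barrierResidual 𝕜 w f b x = x - ∑ a, z a • w (f a) := rfl
  rw [h3, norm_sub_sq (𝕜 := 𝕜), h1, h2, RCLike.ofReal_re]
  ring

/-- The potential is the sum over all `w i` of `invForm`. By `invForm_bordered`, adding `l`
increases it by the Bessel sum of the residual of `w l` divided by the Schur complement, hence by at
most `β * r l / (1 - b' - q' l)`. Lowering the level from `b` to `b'` makes room `Y`, and averaging
over `l` finds a vector that fits. -/
theorem exists_lower_barrier_step [Fintype α] {w : α → E} (hw : ∀ i, ‖w i‖ = 1) {β : ℝ} (hβ0 : 0 < β)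
    (hβ : ∀ x : E, ∑ i, ‖inner 𝕜 x (w i)‖ ^ 2 ≤ β * ‖x‖ ^ 2) [Nonempty α]
    {f : κ → α} {b b' b₀ : ℝ} (hb' : 0 < b') (hbb : b' < b) (hb₀ : 0 < b₀)
    (hM : (shiftedGram 𝕜 w f b).PosDef)
    (hF : ∑ i, invForm (shiftedGram 𝕜 w f b) (innerVec 𝕜 w f (w i)) ≤
      Fintype.card α * (1 - b / b₀))
    (hstep : β ≤ (b - b') * (Fintype.card α * (b₀⁻¹ - 1))) :
    ∃ l, (shiftedGram 𝕜 w (Sum.elim f fun _ : Unit => l) b').PosDef ∧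
      ∑ i, invForm (shiftedGram 𝕜 w (Sum.elim f fun _ : Unit => l) b')
        (innerVec 𝕜 w (Sum.elim f fun _ : Unit => l) (w i)) ≤ Fintype.card α * (1 - b' / b₀) := by
  set N : ℝ := ((Fintype.card α : ℕ) : ℝ) with hN
  have hN0 : 0 < N := by rw [hN]; exact_mod_cast Fintype.card_pos
  set δ := b - b' with hδ
  have hδ0 : 0 < δ := sub_pos.2 hbb
  have hMadd := shiftedGram_add_smul (𝕜 := 𝕜) w f b b'
  have hM' : (shiftedGram 𝕜 w f b').PosDef := by
    rw [hMadd]; exact (Matrix.inv_eq_add_smul_of_posDef hM hδ0.le).1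
  set M := shiftedGram 𝕜 w f b with hMdef
  set M' := shiftedGram 𝕜 w f b' with hM'def
  set q : α → ℝ := fun i => invForm M (innerVec 𝕜 w f (w i)) with hq
  set q' : α → ℝ := fun i => invForm M' (innerVec 𝕜 w f (w i)) with hq'
  set F := ∑ i, q i with hFdef
  set F' := ∑ i, q' i with hF'def
  set r : α → ℝ := fun i => ‖barrierResidual 𝕜 w f b' (w i)‖ ^ 2 with hr
  -- Up to the factor `δ`, the term `b' * ∑ ‖z a‖ ^ 2` in the residual norm is bounded by the drop
  -- of the potential, `b' * (q i - q' i)`.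
  have hres : ∀ i, δ * r i ≤ δ * (1 - q' i) + b' * (q i - q' i) := fun i => by
    have h1 := norm_barrierResidual_sq hM' (w i)
    have h2 := invForm_add_smul_le hM hδ0.le (innerVec 𝕜 w f (w i))
    rw [← hMadd] at h2
    simp only [hr, h1, hw, hq, hq']
    have := mul_le_mul_of_nonneg_left h2 hb'.le
    linarith
  have hq'le : ∀ i, q' i ≤ q i := fun i => by
    have h2 := invForm_add_smul_le hM hδ0.le (innerVec 𝕜 w f (w i))
    rw [← hMadd] at h2
    have : 0 ≤ ∑ a, ‖(M'⁻¹ *ᵥ innerVec 𝕜 w f (w i)) a‖ ^ 2 :=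
      Finset.sum_nonneg fun _ _ => sq_nonneg _
    have := mul_nonneg hδ0.le this
    simp only [hq, hq']; linarith
  have hF'F : F' ≤ F := Finset.sum_le_sum fun i _ => hq'le i
  set Y := N * (1 - b' / b₀) - F' with hY
  have hYpos : 0 < Y := by
    have : b' / b₀ < b / b₀ := div_lt_div_of_pos_right hbb hb₀
    nlinarith
  have hrsum : δ * ∑ i, r i ≤ Y * b := by
    have h1 : δ * ∑ i, r i ≤ δ * (N - F') + b' * (F - F') := by
      calc δ * ∑ i, r i = ∑ i, δ * r i := Finset.mul_sum ..
        _ ≤ ∑ i, (δ * (1 - q' i) + b' * (q i - q' i)) := Finset.sum_le_sum fun i _ => hres i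
        _ = _ := by
          rw [Finset.sum_add_distrib, ← Finset.mul_sum, ← Finset.mul_sum, Finset.sum_sub_distrib,
            Finset.sum_sub_distrib]
          simp [hN, hFdef, hF'def]
    have h2 : b' * F ≤ b' * (N * (1 - b / b₀)) := mul_le_mul_of_nonneg_left hF hb'.le
    have h3 : δ * (N - F') + b' * (N * (1 - b / b₀) - F') = Y * b := by
      rw [hY, hδ]; field_simp; ring
    linarith
  -- The potential bound makes the Schur complements sum to at least `N * b * (b₀⁻¹ - 1)`; `hstep`
  -- turns this into the bound that matches `hrsum`.
  have hssum : δ⁻¹ * (β * b) ≤ ∑ i, (1 - b' - q' i) := by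
    have h1 : ∑ i, (1 - b' - q' i) = N * (1 - b') - F' := by
      rw [Finset.sum_sub_distrib]; simp [hN, hF'def]; ring
    rw [h1, inv_mul_le_iff₀ hδ0]
    have h2 : β * b ≤ δ * (N * (b₀⁻¹ - 1)) * b := mul_le_mul_of_nonneg_right hstep (by linarith)
    have h3 : N * b * (b₀⁻¹ - 1) ≤ N * (1 - b') - F' := by
      have : N * (1 - b / b₀) = N - N * b * b₀⁻¹ := by ring
      nlinarith
    nlinarith
  obtain ⟨l, hl⟩ : ∃ l, β * r l ≤ (1 - b' - q' l) * Y := by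
    by_contra! hcon
    have h1 : ∑ i, (1 - b' - q' i) * Y < ∑ i, β * r i :=
      Finset.sum_lt_sum_of_nonempty Finset.univ_nonempty fun i _ => hcon i
    rw [← Finset.sum_mul, ← Finset.mul_sum] at h1
    have h2 : δ⁻¹ * (β * b) * Y ≤ (∑ i, (1 - b' - q' i)) * Y :=
      mul_le_mul_of_nonneg_right hssum hYpos.le
    have h3 : ∑ i, r i ≤ δ⁻¹ * (Y * b) := by rwa [le_inv_mul_iff₀ hδ0]
    have h4 := mul_le_mul_of_nonneg_left h3 hβ0.le
    linarith [show β * (δ⁻¹ * (Y * b)) = δ⁻¹ * (β * b) * Y by ring]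
  -- A vanishing Schur complement would force the residual of `w l` to vanish, hence `q' l = 1`; but
  -- then `1 - b' = 1`, against `b' > 0`.
  have hs : q' l < 1 - b' := by
    have hr0 : 0 ≤ r l := sq_nonneg _
    have h1 : 0 ≤ (1 - b' - q' l) * Y := le_trans (mul_nonneg hβ0.le hr0) hl
    have h2 : 0 ≤ 1 - b' - q' l := nonneg_of_mul_nonneg_left h1 hYpos
    refine lt_of_le_of_ne (by linarith) fun heq => ?_
    have h3 : β * r l ≤ 0 := by rw [heq] at hl; simpa using hl
    have h4 : r l = 0 := le_antisymm (nonpos_of_mul_nonpos_right h3 hβ0) hr0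
    have h5 : barrierResidual 𝕜 w f b' (w l) = 0 := by
      simpa [hr] using h4
    have h6 := inner_barrierResidual hM' (w l) (w l)
    rw [h5, inner_zero_left, ← ofReal_invForm hM', inner_self_eq_norm_sq_to_K, hw] at h6
    have h7 : ((1 - q' l : ℝ) : 𝕜) = 0 := by
      push_cast; simpa using h6.symm
    rw [RCLike.ofReal_eq_zero] at h7
    linarith
  refine ⟨l, ?_, ?_⟩
  · rw [shiftedGram_sumElim hw]
    exact bordered_posDef hM' hs
  · have h1 : ∀ i, invForm (shiftedGram 𝕜 w (Sum.elim f fun _ : Unit => l) b')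
        (innerVec 𝕜 w (Sum.elim f fun _ : Unit => l) (w i)) =
        q' i + ‖inner 𝕜 (barrierResidual 𝕜 w f b' (w l)) (w i)‖ ^ 2 / (1 - b' - q' l) := fun i => by
      rw [shiftedGram_sumElim hw, innerVec_sumElim, invForm_bordered hM' hs,
        inner_barrierResidual hM']
    rw [Finset.sum_congr rfl fun i _ => h1 i, Finset.sum_add_distrib, ← Finset.sum_div]
    have h2 : (∑ i, ‖inner 𝕜 (barrierResidual 𝕜 w f b' (w l)) (w i)‖ ^ 2) / (1 - b' - q' l) ≤ Y := by
      rw [div_le_iff₀ (by linarith)]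
      exact (hβ _).trans (by linarith [hl, mul_comm Y (1 - b' - q' l)])
    have h3 : F' + Y = N * (1 - b' / b₀) := by rw [hY]; ring
    change F' + _ ≤ _
    linarith

end LowerBarrier

/-- Restricted invertibility: lower Riesz bounds on a large subfamily of a Bessel family of unit
vectors. -/
theorem exists_shiftedGram_posDef {𝕜 E α : Type*} [RCLike 𝕜] [NormedAddCommGroup E]
    [InnerProductSpace 𝕜 E] [Fintype α] [Nonempty α] {w : α → E} (hw : ∀ i, ‖w i‖ = 1) {β : ℝ}
    (hβ0 : 0 < β) (hβ : ∀ x : E, ∑ i, ‖inner 𝕜 x (w i)‖ ^ 2 ≤ β * ‖x‖ ^ 2)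
    {b₀ δ : ℝ} (hb₀ : 0 < b₀) (hδ : 0 < δ) (hstep : β ≤ δ * (Fintype.card α * (b₀⁻¹ - 1)))
    (k : ℕ) (hk : k * δ < b₀) :
    ∃ (κ : Type) (_ : Fintype κ) (_ : DecidableEq κ) (f : κ → α), Fintype.card κ = k ∧
      (shiftedGram 𝕜 w f (b₀ - k * δ)).PosDef ∧
      ∑ i, invForm (shiftedGram 𝕜 w f (b₀ - k * δ)) (innerVec 𝕜 w f (w i)) ≤
        Fintype.card α * (1 - (b₀ - k * δ) / b₀) := by
  induction k with
  | zero =>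
    -- The empty family has potential zero, which is the allowed value at level `b₀`.
    refine ⟨Empty, inferInstance, inferInstance, Empty.elim, by simp, ?_, ?_⟩
    · exact Matrix.PosDef.of_dotProduct_mulVec_pos (by ext i; exact i.elim)
        fun x hx => absurd (Subsingleton.elim x 0) hx
    · simp [invForm, dotProduct, hb₀.ne']
  | succ k ih =>
    push_cast at hk ⊢
    obtain ⟨κ, _, _, f, hcard, hM, hF⟩ := ih (by linarith)
    obtain ⟨l, h1, h2⟩ := exists_lower_barrier_step hw hβ0 hβ (b' := b₀ - (k + 1) * δ)
      (by linarith) (by linarith) hb₀ hM hF (by convert hstep using 2; ring)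
    exact ⟨κ ⊕ Unit, inferInstance, inferInstance, _, by simp [hcard], h1, h2⟩

/-! ### Riesz bounds from Bessel and Gram bounds. -/

theorem norm_sum_smul_sq_le_of_bessel {𝕜 E κ : Type*} [RCLike 𝕜] [NormedAddCommGroup E]
    [InnerProductSpace 𝕜 E] [Fintype κ] {v : κ → E} {β : ℝ} (hβ0 : 0 ≤ β)
    (hβ : ∀ x : E, ∑ a, ‖inner 𝕜 x (v a)‖ ^ 2 ≤ β * ‖x‖ ^ 2) (c : κ → 𝕜) :
    ‖∑ a, c a • v a‖ ^ 2 ≤ β * ∑ a, ‖c a‖ ^ 2 := by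
  set x := ∑ a, c a • v a with hx
  have h1 : ‖x‖ ^ 2 ≤ ∑ a, ‖c a‖ * ‖inner 𝕜 x (v a)‖ := by
    have h : (inner 𝕜 x x : 𝕜) = ∑ a, c a * inner 𝕜 x (v a) := by
      calc (inner 𝕜 x x : 𝕜) = inner 𝕜 x (∑ a, c a • v a) := by rw [← hx]
        _ = _ := by simp [inner_sum, inner_smul_right]
    calc ‖x‖ ^ 2 = ‖(inner 𝕜 x x : 𝕜)‖ := by rw [inner_self_eq_norm_sq_to_K]; simp
      _ ≤ ∑ a, ‖c a * inner 𝕜 x (v a)‖ := by rw [h]; exact norm_sum_le _ _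
      _ = _ := by simp
  have h2 := Finset.sum_mul_sq_le_sq_mul_sq Finset.univ (fun a => ‖c a‖)
    (fun a => ‖inner 𝕜 x (v a)‖)
  have h3 := hβ x
  have hc : 0 ≤ ∑ a, ‖c a‖ ^ 2 := Finset.sum_nonneg fun _ _ => sq_nonneg _
  have h4 : (‖x‖ ^ 2) ^ 2 ≤ (∑ a, ‖c a‖ ^ 2) * (β * ‖x‖ ^ 2) := by
    calc (‖x‖ ^ 2) ^ 2 ≤ (∑ a, ‖c a‖ * ‖inner 𝕜 x (v a)‖) ^ 2 := by gcongr
      _ ≤ _ := h2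
      _ ≤ _ := by gcongr
  rcases (sq_nonneg ‖x‖).eq_or_lt with h0 | h0
  · rw [← h0]; positivity
  · nlinarith

theorem le_norm_sum_smul_sq_of_shiftedGram {𝕜 E α κ : Type*} [RCLike 𝕜] [NormedAddCommGroup E]
    [InnerProductSpace 𝕜 E] [Fintype κ] [DecidableEq κ] {w : α → E} {f : κ → α} {b : ℝ}
    (hM : (shiftedGram 𝕜 w f b).PosDef) (c : κ → 𝕜) :
    b * ∑ a, ‖c a‖ ^ 2 ≤ ‖∑ a, c a • w (f a)‖ ^ 2 := by
  have h := hM.posSemidef.re_dotProduct_nonneg c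
  have h2 := Matrix.star_dotProduct_gram_mulVec (𝕜 := 𝕜) (w ∘ f) c c
  have hzz : star c ⬝ᵥ c = ((∑ a, ‖c a‖ ^ 2 : ℝ) : 𝕜) := by
    simp [dotProduct, RCLike.conj_mul]
  rw [shiftedGram, Matrix.sub_mulVec, dotProduct_sub, h2, Matrix.smul_mulVec, Matrix.one_mulVec,
    dotProduct_smul, hzz, map_sub, RCLike.smul_re, RCLike.ofReal_re] at h
  simp only [Function.comp, inner_self_eq_norm_sq] at h
  linarith

/-- A repeated index would put a difference of two coordinate vectors in the kernel of the synthesis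
map. Thus selection with repetition does no harm. -/
theorem injective_of_riesz {𝕜 E ι κ : Type*} [RCLike 𝕜] [NormedAddCommGroup E]
    [NormedSpace 𝕜 E] [Fintype κ] {w : ι → E} {j : κ → ι} {a : ℝ} (ha : 0 < a)
    (h : ∀ c : κ → 𝕜, a * ∑ i, ‖c i‖ ^ 2 ≤ ‖∑ i, c i • w (j i)‖ ^ 2) : Function.Injective j := by
  classical
  intro p q hpq
  by_contra hne
  have h1 := h (Pi.single p 1 - Pi.single q 1)
  have h2 : ∑ i, (Pi.single p 1 - Pi.single q 1 : κ → 𝕜) i • w (j i) = 0 := by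
    simp [sub_smul, Pi.single_apply, Finset.sum_sub_distrib, ite_smul, hpq]
  rw [h2] at h1
  have h3 : 1 ≤ ∑ i, ‖(Pi.single p 1 - Pi.single q 1 : κ → 𝕜) i‖ ^ 2 := by
    refine le_trans (le_of_eq ?_) (Finset.single_le_sum (fun i _ => sq_nonneg _) (Finset.mem_univ p))
    simp [hne]
  have : 0 < a * ∑ i, ‖(Pi.single p 1 - Pi.single q 1 : κ → 𝕜) i‖ ^ 2 := by positivity
  simp at h1
  simp at this
  linarith

/-! ### Riesz systems inside a Parseval frame. -/

/-- The normalization of a vector. -/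
noncomputable def unitize (𝕜 : Type*) {E : Type*} [RCLike 𝕜] [NormedAddCommGroup E]
    [NormedSpace 𝕜 E] (x : E) : E := ((‖x‖ : 𝕜)⁻¹) • x

theorem norm_unitize {𝕜 E : Type*} [RCLike 𝕜] [NormedAddCommGroup E]
    [NormedSpace 𝕜 E] {x : E} (hx : x ≠ 0) : ‖unitize 𝕜 x‖ = 1 := by
  simp [unitize, norm_smul, hx]

theorem IsParseval.exists_inner_ge {𝕜 ι m : Type*} [RCLike 𝕜] [Fintype m] [DecidableEq m]
    [Nonempty m] {u : ι → EuclideanSpace 𝕜 m} (hu : IsParseval u) {e : EuclideanSpace 𝕜 m}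
    (he : e ≠ 0) : ∃ j, u j ≠ 0 ∧ ‖e‖ ^ 2 ≤ Fintype.card m * ‖inner 𝕜 e (unitize 𝕜 (u j))‖ ^ 2 := by
  set n : ℝ := ((Fintype.card m : ℕ) : ℝ) with hn
  have he0 : 0 < ‖e‖ ^ 2 := by positivity
  have hnorm : ∀ x : EuclideanSpace 𝕜 m, star x.ofLp ⬝ᵥ x.ofLp = ((‖x‖ ^ 2 : ℝ) : 𝕜) := fun x => by
    rw [EuclideanSpace.norm_sq_eq]
    simp [dotProduct, RCLike.conj_mul]
  -- The test matrix has trace `2 n - n = n`; the coefficient `2` leaves one `‖u j‖ ^ 2` on the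
  -- favourable side.
  obtain ⟨j, hj0, hj⟩ := hu.exists_form_le (M := (2 : ℝ) • 1 - (n / ‖e‖ ^ 2) •
    Matrix.vecMulVec e.ofLp (star e.ofLp)) (by
      rw [Matrix.trace_sub, Matrix.trace_smul, Matrix.trace_smul, Matrix.trace_vecMulVec, map_sub,
        RCLike.smul_re, RCLike.smul_re, dotProduct_comm, hnorm, RCLike.ofReal_re,
        div_mul_cancel₀ _ he0.ne']
      simp [← hn]; linarith)
  refine ⟨j, hj0, ?_⟩
  have h2 : RCLike.re (star (u j).ofLp ⬝ᵥ Matrix.vecMulVec e.ofLp (star e.ofLp) *ᵥ (u j).ofLp) =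
      ‖inner 𝕜 e (u j)‖ ^ 2 := by
    rw [Matrix.vecMulVec_mulVec, dotProduct_smul, MulOpposite.smul_eq_mul_unop,
      MulOpposite.unop_op, EuclideanSpace.inner_eq_star_dotProduct, dotProduct_comm (u j).ofLp]
    have h2 : star (u j).ofLp ⬝ᵥ e.ofLp = star (star e.ofLp ⬝ᵥ (u j).ofLp) := by
      rw [Matrix.star_dotProduct]
    have h3 := RCLike.conj_mul (star e.ofLp ⬝ᵥ (u j).ofLp)
    rw [starRingEnd_apply] at h3
    rw [h2, h3, ← RCLike.ofReal_pow, RCLike.ofReal_re]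
  rw [Matrix.sub_mulVec, dotProduct_sub, map_sub, Matrix.smul_mulVec, Matrix.smul_mulVec,
    dotProduct_smul, dotProduct_smul, RCLike.smul_re, RCLike.smul_re, h2, Matrix.one_mulVec, hnorm,
    RCLike.ofReal_re] at hj
  have hu0 : 0 < ‖u j‖ ^ 2 := by positivity
  rw [unitize, inner_smul_right, norm_mul, mul_pow]
  have h3 : ‖u j‖ ^ 2 ≤ n / ‖e‖ ^ 2 * ‖inner 𝕜 e (u j)‖ ^ 2 := by linarith
  rw [div_mul_eq_mul_div, le_div_iff₀ he0] at h3
  have h4 : ‖((‖u j‖ : 𝕜))⁻¹‖ ^ 2 = (‖u j‖ ^ 2)⁻¹ := by simp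
  rw [h4, mul_left_comm, le_inv_mul_iff₀ hu0]
  exact h3

/-- Greedy choice of a linearly independent system from a Parseval frame, with dimension dependent
lower Riesz bounds. -/
theorem IsParseval.exists_greedy {𝕜 ι : Type*} [RCLike 𝕜] {n : ℕ} (hn : 0 < n)
    {u : ι → EuclideanSpace 𝕜 (Fin n)} (hu : IsParseval u) (k : ℕ) (hk : k ≤ n) :
    ∃ j : Fin k → ι, (∀ i, u (j i) ≠ 0) ∧ ∀ c : Fin k → 𝕜,
      ∑ i, ‖c i‖ ^ 2 ≤ (4 * ((n : ℝ) + 1)) ^ k * ‖∑ i, c i • unitize 𝕜 (u (j i))‖ ^ 2 := by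
  have : Nonempty (Fin n) := ⟨⟨0, hn⟩⟩
  induction k with
  | zero => exact ⟨Fin.elim0, fun i => i.elim0, fun c => by simp⟩
  | succ k ih =>
    obtain ⟨j, hj0, hj⟩ := ih (by omega)
    set K := Submodule.span 𝕜 (Set.range fun i => unitize 𝕜 (u (j i))) with hK
    have hKtop : Kᗮ ≠ ⊥ := by
      rw [Ne, Submodule.orthogonal_eq_bot_iff]
      intro htop
      have h1 : Module.finrank 𝕜 K ≤ k := by
        simpa [Set.finrank] using finrank_range_le_card (R := 𝕜) (fun i => unitize 𝕜 (u (j i)))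
      rw [htop, finrank_top, finrank_euclideanSpace_fin] at h1
      omega
    -- Testing against `e`, orthogonal to the vectors already chosen, isolates the new coefficient
    -- `t`; the triangle inequality then controls the old part `x`.
    obtain ⟨e, heK, he0⟩ := Submodule.exists_mem_ne_zero_of_ne_bot hKtop
    obtain ⟨l, hl0, hl⟩ := hu.exists_inner_ge he0
    rw [Fintype.card_fin] at hl
    refine ⟨Fin.snoc j l, fun i => ?_, fun c => ?_⟩
    · refine Fin.lastCases ?_ (fun i => ?_) i
      · simpa using hl0
      · simpa using hj0 i
    rw [Fin.sum_univ_castSucc, Fin.sum_univ_castSucc]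
    simp only [Fin.snoc_castSucc, Fin.snoc_last]
    set x := ∑ i : Fin k, c i.castSucc • unitize 𝕜 (u (j i)) with hx
    set t := c (Fin.last k) with ht
    set v := unitize 𝕜 (u l) with hv
    have hv1 : ‖v‖ = 1 := norm_unitize hl0
    have hxK : x ∈ K := Submodule.sum_mem _ fun i _ => Submodule.smul_mem _ _
      (Submodule.subset_span ⟨i, rfl⟩)
    have hex : inner 𝕜 e x = 0 := (Submodule.mem_orthogonal' K e).1 heK x hxK
    have h1 : inner 𝕜 e (x + t • v) = t * inner 𝕜 e v := by
      rw [inner_add_right, hex, zero_add, inner_smul_right]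
    have h2 : ‖t‖ * ‖inner 𝕜 e v‖ ≤ ‖e‖ * ‖x + t • v‖ := by
      rw [← norm_mul, ← h1]; exact norm_inner_le_norm _ _
    have h3 : ‖t‖ ^ 2 ≤ n * ‖x + t • v‖ ^ 2 := by
      have he2 : 0 < ‖e‖ ^ 2 := by positivity
      have h4 : (‖t‖ * ‖inner 𝕜 e v‖) ^ 2 ≤ (‖e‖ * ‖x + t • v‖) ^ 2 := by gcongr
      have h5 := mul_le_mul_of_nonneg_left hl (sq_nonneg ‖t‖)
      have h6 := mul_le_mul_of_nonneg_left h4 (Nat.cast_nonneg (α := ℝ) n)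
      have : ‖e‖ ^ 2 * ‖t‖ ^ 2 ≤ ‖e‖ ^ 2 * (n * ‖x + t • v‖ ^ 2) := by linarith
      exact le_of_mul_le_mul_left this he2
    have h4 : ‖x‖ ^ 2 ≤ 2 * ‖x + t • v‖ ^ 2 + 2 * ‖t‖ ^ 2 := by
      have h5 : ‖x‖ ≤ ‖x + t • v‖ + ‖t‖ := by
        calc ‖x‖ = ‖(x + t • v) - t • v‖ := by simp
          _ ≤ ‖x + t • v‖ + ‖t • v‖ := norm_sub_le _ _
          _ = _ := by rw [norm_smul, hv1, mul_one]
      have h6 : ‖x‖ ^ 2 ≤ (‖x + t • v‖ + ‖t‖) ^ 2 := by gcongr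
      nlinarith [sq_nonneg (‖x + t • v‖ - ‖t‖)]
    have h5 := hj fun i => c i.castSucc
    have hC : (1 : ℝ) ≤ (4 * ((n : ℝ) + 1)) ^ k := one_le_pow₀ (by
      have : (0 : ℝ) ≤ n := Nat.cast_nonneg n
      linarith)
    set C := (4 * ((n : ℝ) + 1)) ^ k with hCdef
    rw [pow_succ _ k, ← hCdef]
    have hn0 : (0 : ℝ) ≤ n := Nat.cast_nonneg n
    have h6 : C * ‖x‖ ^ 2 ≤ C * (2 * (n + 1) * ‖x + t • v‖ ^ 2) := by
      gcongr; linarith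
    have h7 : n * ‖x + t • v‖ ^ 2 ≤ C * ((n + 1) * ‖x + t • v‖ ^ 2) := by
      have : (n + 1) * ‖x + t • v‖ ^ 2 ≤ C * ((n + 1) * ‖x + t • v‖ ^ 2) :=
        le_mul_of_one_le_left (by positivity) hC
      have : 0 ≤ ‖x + t • v‖ ^ 2 := sq_nonneg _
      linarith
    have h8 : 0 ≤ C * ((n + 1) * ‖x + t • v‖ ^ 2) := by positivity
    have : C * (4 * (↑n + 1)) * ‖x + t • v‖ ^ 2 = 4 * (C * ((n + 1) * ‖x + t • v‖ ^ 2)) := by ring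
    rw [this]
    linarith

theorem injective_of_shiftedGram {𝕜 E ι α κ : Type*} [RCLike 𝕜] [NormedAddCommGroup E]
    [InnerProductSpace 𝕜 E] [Fintype κ] [DecidableEq κ] {w : ι → E} {J : α → ι} {f : κ → α} {b : ℝ}
    (hb : 0 < b) (hM : (shiftedGram 𝕜 (w ∘ J) f b).PosDef) : Function.Injective f :=
  .of_comp (f := J) <| injective_of_riesz hb (w := w) (j := J ∘ f)
    fun c => le_norm_sum_smul_sq_of_shiftedGram (w := w ∘ J) hM c

/-- Selection from a Parseval frame with parameters `k` and `M` subject to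
`k (M + 1)² < n M (M - 1)`. -/
theorem IsParseval.exists_riesz_of_barrier {𝕜 ι : Type*} [RCLike 𝕜] {n : ℕ} (hn : 0 < n)
    {u : ι → EuclideanSpace 𝕜 (Fin n)} (hu : IsParseval u) {M : ℕ} (hM : 2 ≤ M) {k : ℕ} {θ : ℝ}
    (hθ : 0 < θ) (hk : (k : ℝ) * ((M : ℝ) + 1) ^ 2 ≤ (1 - θ) * (n * M * (M - 1))) :
    ∃ (κ : Type) (_ : Fintype κ) (j : κ → ι), Fintype.card κ = k ∧ (∀ i, u (j i) ≠ 0) ∧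
      ∀ c : κ → 𝕜, θ / M * ∑ i, ‖c i‖ ^ 2 ≤ ‖∑ i, c i • unitize 𝕜 (u (j i))‖ ^ 2 ∧
        ‖∑ i, c i • unitize 𝕜 (u (j i))‖ ^ 2 ≤ ((M : ℝ) + 1) ^ 2 * ∑ i, ‖c i‖ ^ 2 := by
  have : Nonempty (Fin n) := ⟨⟨0, hn⟩⟩
  have hn' : (0 : ℝ) < n := by exact_mod_cast hn
  have hM' : (2 : ℝ) ≤ M := by exact_mod_cast hM
  have hM0 : (0 : ℝ) < M := by linarith
  -- These values give equality in the barrier condition: `n M / (M + 1) + n / (M + 1) = n`.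
  obtain ⟨J, hJ0, hJ⟩ := hu.exists_bessel (δ := (M + 1) / (n * M)) (β₀ := M + 1) (by positivity)
    (by positivity) (by rw [Fintype.card_fin]; apply le_of_eq; field_simp) (n * M ^ 2)
  have hβ : (M + 1 : ℝ) + ((n * M ^ 2 : ℕ) : ℝ) * ((M + 1) / (n * M)) = (M + 1) ^ 2 := by
    push_cast; field_simp; ring
  rw [hβ] at hJ
  have hN : 0 < n * M ^ 2 := by positivity
  have : Nonempty (Fin (n * M ^ 2)) := ⟨⟨0, hN⟩⟩
  -- The least step allowed by `hstep` with `b₀ = 1 / M`; by `hk`, after `k` steps the level is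
  -- still at least `θ / M`.
  set δ : ℝ := (M + 1) ^ 2 / (n * M ^ 2 * (M - 1)) with hδ
  have hM1 : (0 : ℝ) < M - 1 := by linarith
  have hkδ : k * δ ≤ (1 - θ) * (M : ℝ)⁻¹ := by
    rw [hδ, ← mul_div_assoc, div_le_iff₀ (by positivity)]
    refine hk.trans (le_of_eq ?_)
    field_simp
  have hMi : (0 : ℝ) < (M : ℝ)⁻¹ := by positivity
  obtain ⟨κ, _, _, f, hcard, hpos, -⟩ := exists_shiftedGram_posDef (𝕜 := 𝕜)
    (w := (fun i => unitize 𝕜 (u i)) ∘ J) (β := ((M : ℝ) + 1) ^ 2) (b₀ := (M : ℝ)⁻¹) (δ := δ)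
    (fun i => norm_unitize (hJ0 i)) (by positivity) hJ hMi (by positivity)
    (by rw [Fintype.card_fin, hδ]; apply le_of_eq; push_cast; field_simp) k (by nlinarith)
  have hb : θ / M ≤ (M : ℝ)⁻¹ - k * δ := by
    rw [div_eq_mul_inv]; linarith
  have hθM : 0 < θ / M := by positivity
  have hinj := injective_of_shiftedGram (hθM.trans_le hb) hpos
  refine ⟨κ, inferInstance, J ∘ f, hcard, fun i => hJ0 _, fun c => ⟨?_, ?_⟩⟩
  · refine le_trans ?_ (le_norm_sum_smul_sq_of_shiftedGram hpos c)
    gcongr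
  · refine norm_sum_smul_sq_le_of_bessel (by positivity) (fun x => le_trans ?_ (hJ x)) c
    -- Injectivity of `f` makes the selected sum a subsum of the full Bessel sum.
    have := Finset.sum_le_univ_sum_of_nonneg (s := Finset.univ.map ⟨f, hinj⟩)
      (fun i => sq_nonneg ‖inner 𝕜 x (unitize 𝕜 (u (J i)))‖)
    rwa [Finset.sum_map] at this

/-- The lower Riesz bound obtained from the parameter `ε`. -/
noncomputable def rieszLower (ε : ℝ) : ℝ :=
  min (ε / 4 / ⌈16 / ε⌉₊) (((4 * (⌈16 / ε⌉₊ : ℝ)) ^ ⌈16 / ε⌉₊)⁻¹)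

/-- The upper Riesz bound obtained from the parameter `ε`. -/
noncomputable def rieszUpper (ε : ℝ) : ℝ := ((⌈16 / ε⌉₊ : ℝ) + 1) ^ 2

theorem rieszLower_pos {ε : ℝ} (hε : 0 < ε) : 0 < rieszLower ε := by
  have : 0 < ⌈16 / ε⌉₊ := Nat.ceil_pos.2 (by positivity)
  unfold rieszLower
  positivity

theorem rieszUpper_pos (ε : ℝ) : 0 < rieszUpper ε := by
  unfold rieszUpper
  positivity

theorem IsParseval.exists_riesz {𝕜 ι : Type*} [RCLike 𝕜] {n : ℕ} (hn : 0 < n)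
    {u : ι → EuclideanSpace 𝕜 (Fin n)} (hu : IsParseval u) {ε : ℝ} (hε : 0 < ε) (hε1 : ε ≤ 1) :
    ∃ (κ : Type) (_ : Fintype κ) (j : κ → ι), (1 - ε) * n < Fintype.card κ ∧ (∀ i, u (j i) ≠ 0) ∧
      ∀ c : κ → 𝕜, rieszLower ε * ∑ i, ‖c i‖ ^ 2 ≤ ‖∑ i, c i • unitize 𝕜 (u (j i))‖ ^ 2 ∧
        ‖∑ i, c i • unitize 𝕜 (u (j i))‖ ^ 2 ≤ rieszUpper ε * ∑ i, ‖c i‖ ^ 2 := by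
  set M := ⌈16 / ε⌉₊ with hMdef
  have hMε : 16 ≤ M * ε := by rw [← div_le_iff₀ hε]; exact Nat.le_ceil _
  have hM16 : (16 : ℝ) ≤ M := by
    have : (M : ℝ) * ε ≤ M * 1 := by gcongr
    linarith
  have hn' : (0 : ℝ) < n := by exact_mod_cast hn
  have hsum : ∀ {κ : Type} [Fintype κ] (c : κ → 𝕜), 0 ≤ ∑ i, ‖c i‖ ^ 2 :=
    fun c => Finset.sum_nonneg fun _ _ => sq_nonneg _
  by_cases hlarge : 2 ≤ ε * n
  -- Rounding up costs at most one vector, and `1 ≤ ε n / 2`. Half of the remaining slack becomes `θ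
  -- = ε / 4`; `M ε ≥ 16` absorbs the gap between `(M + 1) ^ 2` and `M * (M - 1)`.
  · set k := ⌊(1 - ε) * n⌋₊ + 1 with hk
    have hk1 : (1 - ε) * n < k := by rw [hk]; exact_mod_cast Nat.lt_floor_add_one _
    have hk2 : (k : ℝ) ≤ (1 - ε / 2) * n := by
      have := Nat.floor_le (a := (1 - ε) * (n : ℝ)) (mul_nonneg (by linarith) hn'.le)
      rw [hk]; push_cast; linarith
    have hkey : (k : ℝ) * ((M : ℝ) + 1) ^ 2 ≤ (1 - ε / 4) * (n * M * (M - 1)) := by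
      have h1 : (1 - ε / 2) * ((M : ℝ) + 1) ^ 2 ≤ (1 - ε / 4) * (M * (M - 1)) := by
        nlinarith [mul_le_mul_of_nonneg_left hMε (by linarith : (0 : ℝ) ≤ M)]
      calc (k : ℝ) * ((M : ℝ) + 1) ^ 2 ≤ (1 - ε / 2) * n * ((M : ℝ) + 1) ^ 2 := by gcongr
        _ = n * ((1 - ε / 2) * ((M : ℝ) + 1) ^ 2) := by ring
        _ ≤ n * ((1 - ε / 4) * (M * (M - 1))) := by gcongr
        _ = _ := by ring
    obtain ⟨κ, _, j, hcard, h0, h⟩ := hu.exists_riesz_of_barrier hn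
      (by exact_mod_cast (by linarith : (2 : ℝ) ≤ M)) (by positivity) hkey
    refine ⟨κ, inferInstance, j, by rw [hcard]; exact hk1, h0, fun c => ⟨?_, (h c).2⟩⟩
    exact le_trans (mul_le_mul_of_nonneg_right (min_le_left _ _) (hsum c)) (h c).1
  · push Not at hlarge
    obtain ⟨j, h0, h⟩ := hu.exists_greedy hn n le_rfl
    -- Now `n` is bounded in terms of `ε`, so the greedy constant is too, and all `n` vectors can be
    -- kept.
    have hnM : (n : ℝ) + 1 ≤ M := by
      have : ε * (n + 1) ≤ ε * M := by nlinarith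
      exact le_of_mul_le_mul_left this hε
    refine ⟨Fin n, inferInstance, j, by rw [Fintype.card_fin]; nlinarith, h0, fun c => ⟨?_, ?_⟩⟩
    · have hMpos : 0 < (4 * (M : ℝ)) ^ M := by positivity
      refine le_trans (mul_le_mul_of_nonneg_right (min_le_right _ _) (hsum c)) ?_
      rw [← hMdef, inv_mul_le_iff₀ hMpos]
      refine (h c).trans (mul_le_mul_of_nonneg_right ?_ (sq_nonneg _))
      calc (4 * ((n : ℝ) + 1)) ^ n ≤ (4 * (M : ℝ)) ^ n := by gcongr
        _ ≤ _ := pow_le_pow_right₀ (by linarith) (by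
          have : (n : ℝ) ≤ M := by linarith
          exact_mod_cast this)
    · have h1 : ‖∑ i, c i • unitize 𝕜 (u (j i))‖ ≤ ∑ i, ‖c i‖ :=
        (norm_sum_le _ _).trans (Finset.sum_le_sum fun i _ => by
          rw [norm_smul, norm_unitize (h0 i), mul_one])
      have h2 := sq_sum_le_card_mul_sum_sq (s := Finset.univ) (f := fun i => ‖c i‖)
      rw [Finset.card_fin] at h2
      calc ‖∑ i, c i • unitize 𝕜 (u (j i))‖ ^ 2 ≤ (∑ i, ‖c i‖) ^ 2 := by gcongr
        _ ≤ n * ∑ i, ‖c i‖ ^ 2 := h2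
        _ ≤ _ := by
          refine mul_le_mul_of_nonneg_right ?_ (hsum c)
          rw [rieszUpper, ← hMdef]
          nlinarith

/-! ### The frame operator and whitening. -/

/-- The analysis operator of a Bessel family in a finite-dimensional space. -/
theorem exists_analysis_operator {𝕜 H ι : Type*} [RCLike 𝕜] [NormedAddCommGroup H]
    [InnerProductSpace 𝕜 H] [FiniteDimensional 𝕜 H] {x : ι → H}
    (hx : ∀ v : H, Summable fun j => ‖(inner 𝕜 v (x j) : 𝕜)‖ ^ 2) :
    ∃ Θ : H →L[𝕜] lp (fun _ : ι => 𝕜) 2, ∀ v j, Θ v j = inner 𝕜 (x j) v := by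
  have hmem : ∀ v : H, Memℓp (fun j => (inner 𝕜 (x j) v : 𝕜)) 2 := fun v => by
    refine memℓp_gen ?_
    simpa [norm_inner_symm] using hx v
  exact ⟨LinearMap.toContinuousLinearMap
    { toFun := fun v => ⟨fun j => inner 𝕜 (x j) v, hmem v⟩
      map_add' := fun v v' => by ext j; exact inner_add_right _ _ _
      map_smul' := fun a v => by ext j; exact inner_smul_right _ _ _ }, fun v j => rfl⟩

/-- A continuous linear map on a finite-dimensional space maps some orthonormal basis to an
orthogonal system. -/
theorem ContinuousLinearMap.exists_orthonormalBasis_inner_map {𝕜 H K : Type*} [RCLike 𝕜]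
    [NormedAddCommGroup H] [InnerProductSpace 𝕜 H] [FiniteDimensional 𝕜 H] [NormedAddCommGroup K]
    [InnerProductSpace 𝕜 K] [CompleteSpace K] {n : ℕ} (hH : Module.finrank 𝕜 H = n)
    (Θ : H →L[𝕜] K) : ∃ b : OrthonormalBasis (Fin n) 𝕜 H, ∀ k l,
      inner 𝕜 (Θ (b k)) (Θ (b l)) = if k = l then ((‖Θ (b k)‖ ^ 2 : ℝ) : 𝕜) else 0 := by
  have : CompleteSpace H := FiniteDimensional.complete 𝕜 H
  -- Eigenvectors of `Θ* Θ`, which is the frame operator when `Θ` is the analysis operator, have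
  -- orthogonal images under `Θ`.
  let T : H →ₗ[𝕜] H := (ContinuousLinearMap.adjoint Θ ∘L Θ : H →L[𝕜] H)
  have hT : ∀ v v', inner 𝕜 v (T v') = inner 𝕜 (Θ v) (Θ v') := fun v v' => by
    change inner 𝕜 v (ContinuousLinearMap.adjoint Θ (Θ v')) = _
    rw [ContinuousLinearMap.adjoint_inner_right]
  have hTs : T.IsSymmetric := fun v v' => by
    rw [hT, ← inner_conj_symm, hT, inner_conj_symm]
  refine ⟨hTs.eigenvectorBasis hH, fun k l => ?_⟩
  split_ifs with h
  · rw [h, inner_self_eq_norm_sq_to_K]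
    simp
  · rw [← hT, hTs.apply_eigenvectorBasis, inner_smul_right,
      (hTs.eigenvectorBasis hH).orthonormal.2 h, mul_zero]

/-- The frame operator of a frame is diagonal in some orthonormal basis, with eigenvalues between the
frame bounds. -/
theorem HasFrameBounds.exists_diagonalization {𝕜 H ι : Type*} [RCLike 𝕜] [NormedAddCommGroup H]
    [InnerProductSpace 𝕜 H] [FiniteDimensional 𝕜 H] {n : ℕ} (hH : Module.finrank 𝕜 H = n)
    {x : ι → H} {A B : ℝ} (hx : HasFrameBounds 𝕜 x A B) :
    ∃ (b : OrthonormalBasis (Fin n) 𝕜 H) (μ : Fin n → ℝ), (∀ k, A ≤ μ k ∧ μ k ≤ B) ∧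
      ∀ k l, HasSum (fun j => inner 𝕜 (b k) (x j) * star (inner 𝕜 (b l) (x j) : 𝕜))
        (if k = l then (μ k : 𝕜) else 0) := by
  obtain ⟨-, -, hx⟩ := hx
  obtain ⟨Θ, hΘ⟩ := exists_analysis_operator fun v => (hx v).1
  obtain ⟨b, hb⟩ := Θ.exists_orthonormalBasis_inner_map hH
  have hsum : ∀ v v', HasSum (fun j => inner 𝕜 v (x j) * star (inner 𝕜 v' (x j) : 𝕜))
      (inner 𝕜 (Θ v) (Θ v')) := fun v v' => by
    have e : (fun j => inner 𝕜 v (x j) * star (inner 𝕜 v' (x j) : 𝕜)) =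
        fun j => inner 𝕜 (Θ v j) (Θ v' j) := by
      funext j
      rw [hΘ, hΘ, RCLike.inner_apply, inner_conj_symm, mul_comm]
      congr 1
      exact inner_conj_symm _ _
    rw [e]
    exact lp.hasSum_inner (𝕜 := 𝕜) (Θ v) (Θ v')
  have hnorm : ∀ v, ‖Θ v‖ ^ 2 = ∑' j, ‖(inner 𝕜 v (x j) : 𝕜)‖ ^ 2 := fun v => by
    have := lp.norm_rpow_eq_tsum (p := 2) (by norm_num) (Θ v)
    simpa [hΘ, norm_inner_symm] using this
  refine ⟨b, fun k => ‖Θ (b k)‖ ^ 2, fun k => ?_, fun k l => ?_⟩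
  · have h := (hx (b k)).2
    simpa [hnorm] using h
  · rw [← hb]
    exact hsum _ _

/-- Whitening: a frame of an `n`-dimensional space is the image of a Parseval frame under an
isomorphism controlled by the frame bounds. -/
theorem HasFrameBounds.exists_whitening {𝕜 H ι : Type*} [RCLike 𝕜] [NormedAddCommGroup H]
    [InnerProductSpace 𝕜 H] {n : ℕ} (hn : 0 < n) (hH : Module.finrank 𝕜 H = n) {x : ι → H} {A B : ℝ}
    (hx : HasFrameBounds 𝕜 x A B) :
    ∃ L : H →ₗ[𝕜] EuclideanSpace 𝕜 (Fin n), IsParseval (fun j => L (x j)) ∧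
      ∀ v, A * ‖L v‖ ^ 2 ≤ ‖v‖ ^ 2 ∧ ‖v‖ ^ 2 ≤ B * ‖L v‖ ^ 2 := by
  have : FiniteDimensional 𝕜 H := Module.finite_of_finrank_pos (by omega)
  obtain ⟨b, μ, hμ, hsum⟩ := hx.exists_diagonalization hH
  have hμ0 : ∀ k, 0 < μ k := fun k => hx.1.trans_le (hμ k).1
  -- `L` is `S^{-1/2}` in coordinates of the eigenbasis of the frame operator `S`.
  let L : H →ₗ[𝕜] EuclideanSpace 𝕜 (Fin n) :=
    { toFun := fun v => WithLp.toLp 2 fun k => ((√(μ k) : ℝ) : 𝕜)⁻¹ * inner 𝕜 (b k) v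
      map_add' := fun v v' => by ext k; simp [inner_add_right, mul_add]
      map_smul' := fun a v => by ext k; simp [inner_smul_right]; ring }
  have hL : ∀ v k, L v k = ((√(μ k) : ℝ) : 𝕜)⁻¹ * inner 𝕜 (b k) v := fun _ _ => rfl
  have hLn : ∀ v, ‖L v‖ ^ 2 = ∑ k, (μ k)⁻¹ * ‖(inner 𝕜 (b k) v : 𝕜)‖ ^ 2 := fun v => by
    rw [EuclideanSpace.norm_sq_eq]
    refine Finset.sum_congr rfl fun k _ => ?_
    rw [hL, norm_mul, mul_pow, norm_inv, RCLike.norm_ofReal, abs_of_nonneg (Real.sqrt_nonneg _),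
      inv_pow, Real.sq_sqrt (hμ0 k).le]
  refine ⟨L, fun k l => ?_, fun v => ?_⟩
  · have h := (hsum k l).mul_left (((√(μ k) : ℝ) : 𝕜)⁻¹ * ((√(μ l) : ℝ) : 𝕜)⁻¹)
    have e1 : (fun j => L (x j) k * star (L (x j) l)) = fun j => ((√(μ k) : ℝ) : 𝕜)⁻¹ *
        ((√(μ l) : ℝ) : 𝕜)⁻¹ * (inner 𝕜 (b k) (x j) * star (inner 𝕜 (b l) (x j))) := by
      funext j
      rw [hL, hL, star_mul']
      simp
      ring
    have e2 : ((√(μ k) : ℝ) : 𝕜)⁻¹ * ((√(μ l) : ℝ) : 𝕜)⁻¹ * (if k = l then (μ k : 𝕜) else 0) =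
        if k = l then 1 else 0 := by
      split_ifs with hkl
      · subst hkl
        have h0 : ((√(μ k) : ℝ) : 𝕜) ≠ 0 := by
          rw [Ne, RCLike.ofReal_eq_zero]; exact (Real.sqrt_pos.2 (hμ0 k)).ne'
        have h1 : (μ k : 𝕜) = ((√(μ k) : ℝ) : 𝕜) * ((√(μ k) : ℝ) : 𝕜) := by
          rw [← RCLike.ofReal_mul, Real.mul_self_sqrt (hμ0 k).le]
        rw [h1]; field_simp
      · simp
    rw [← e1, e2] at h
    exact h
  · rw [hLn, ← b.sum_sq_norm_inner_right v, Finset.mul_sum, Finset.mul_sum]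
    constructor
    · refine Finset.sum_le_sum fun k _ => ?_
      rw [← mul_assoc]
      refine mul_le_of_le_one_left (sq_nonneg _) ?_
      rw [← div_eq_mul_inv, div_le_one (hμ0 k)]
      exact (hμ k).1
    · refine Finset.sum_le_sum fun k _ => ?_
      rw [← mul_assoc]
      refine le_mul_of_one_le_left (sq_nonneg _) ?_
      rw [← div_eq_mul_inv, one_le_div (hμ0 k)]
      exact (hμ k).2

/-! ### Equivalence with an orthogonal basis and the final assembly. -/

theorem closedSpan_eq_span {𝕜 E σ : Type*} [RCLike 𝕜] [NormedAddCommGroup E] [NormedSpace 𝕜 E]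
    [Finite σ] (v : σ → E) : closedSpan 𝕜 v = Submodule.span 𝕜 (Set.range v) := by
  have : FiniteDimensional 𝕜 (Submodule.span 𝕜 (Set.range v)) :=
    FiniteDimensional.span_of_finite 𝕜 (Set.finite_range v)
  exact (Submodule.closed_of_finiteDimensional _).submodule_topologicalClosure_eq

theorem isEquivalentWith_of_norm_sq {𝕜 E F σ : Type*} [RCLike 𝕜] [NormedAddCommGroup E]
    [NormedSpace 𝕜 E] [NormedAddCommGroup F] [NormedSpace 𝕜 F] [Fintype σ] {v : σ → E} {y : σ → F}
    (hy : LinearIndependent 𝕜 y) {p q : ℝ} (hp : 0 < p) (hq : 0 ≤ q)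
    (hpv : ∀ c : σ → 𝕜, p * ‖∑ i, c i • y i‖ ^ 2 ≤ ‖∑ i, c i • v i‖ ^ 2)
    (hqv : ∀ c : σ → 𝕜, ‖∑ i, c i • v i‖ ^ 2 ≤ q * ‖∑ i, c i • y i‖ ^ 2) :
    IsEquivalentWith 𝕜 (√(q / p)) v y := by
  have hv : LinearIndependent 𝕜 v := by
    rw [Fintype.linearIndependent_iff] at hy ⊢
    intro c hc
    refine hy c ?_
    have h := hpv c
    rw [hc, norm_zero] at h
    have h2 : ‖∑ i, c i • y i‖ ^ 2 ≤ 0 := by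
      by_contra! h3
      nlinarith [mul_pos hp h3]
    simpa using le_antisymm h2 (sq_nonneg _)
  let bv : Module.Basis σ 𝕜 (closedSpan 𝕜 v) :=
    (Module.Basis.span hv).map (LinearEquiv.ofEq _ _ (closedSpan_eq_span v).symm)
  let b' : Module.Basis σ 𝕜 (closedSpan 𝕜 y) :=
    (Module.Basis.span hy).map (LinearEquiv.ofEq _ _ (closedSpan_eq_span y).symm)
  have hbv : ∀ i, bv i = ⟨v i, mem_closedSpan 𝕜 v i⟩ := fun i => by
    apply Subtype.ext; simp [bv, Module.Basis.span_apply]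
  have hby : ∀ i, b' i = ⟨y i, mem_closedSpan 𝕜 y i⟩ := fun i => by
    apply Subtype.ext; simp [b', Module.Basis.span_apply]
  have : FiniteDimensional 𝕜 (closedSpan 𝕜 v) := bv.finiteDimensional_of_finite
  let T := (bv.equiv b' (Equiv.refl σ)).toContinuousLinearEquiv
  have hTb : ∀ i, T (bv i) = b' i := fun i => bv.equiv_apply i b' (Equiv.refl σ)
  have hcoe : ∀ z, ((z : closedSpan 𝕜 v) : E) = ∑ i, bv.repr z i • v i := fun z => by
    conv_lhs => rw [← bv.sum_repr z]
    simp [hbv]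
  have hTcoe : ∀ z, ((T z : closedSpan 𝕜 y) : F) = ∑ i, bv.repr z i • y i := fun z => by
    conv_lhs => rw [← bv.sum_repr z, map_sum]
    simp only [map_smul, hTb, hby, Submodule.coe_sum, Submodule.coe_smul]
  refine ⟨T, fun i => by rw [← hbv, ← hby, hTb], ?_⟩
  have h1 : ‖(T : closedSpan 𝕜 v →L[𝕜] closedSpan 𝕜 y)‖ ≤ √(p⁻¹) := by
    refine ContinuousLinearMap.opNorm_le_bound _ (Real.sqrt_nonneg _) fun z => ?_
    refine (sq_le_sq₀ (norm_nonneg _) (by positivity)).1 ?_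
    rw [mul_pow, Real.sq_sqrt (inv_nonneg.2 hp.le), le_inv_mul_iff₀ hp]
    have := hpv fun i => bv.repr z i
    rwa [← hcoe, ← hTcoe] at this
  have h2 : ‖(T.symm : closedSpan 𝕜 y →L[𝕜] closedSpan 𝕜 v)‖ ≤ √q := by
    refine ContinuousLinearMap.opNorm_le_bound _ (Real.sqrt_nonneg _) fun z => ?_
    obtain ⟨z, rfl⟩ := T.surjective z
    have := hqv fun i => bv.repr z i
    rw [← hcoe, ← hTcoe] at this
    refine (sq_le_sq₀ (norm_nonneg _) (by positivity)).1 ?_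
    rw [mul_pow, Real.sq_sqrt hq]
    simpa using this
  calc _ ≤ √(p⁻¹) * √q := mul_le_mul h1 h2 (norm_nonneg _) (Real.sqrt_nonneg _)
    _ = _ := by rw [← Real.sqrt_mul (by positivity), div_eq_inv_mul]

theorem isOrthogonalBasis_smul_single {𝕜 σ : Type*} [RCLike 𝕜] [Fintype σ] [DecidableEq σ]
    {r : σ → ℝ} (hr : ∀ i, r i ≠ 0) :
    IsOrthogonalBasis 𝕜 fun i => (r i : 𝕜) • (EuclideanSpace.single i 1 : EuclideanSpace 𝕜 σ) := by
  have hr' : ∀ i, (r i : 𝕜) ≠ 0 := fun i => by rw [Ne, RCLike.ofReal_eq_zero]; exact hr i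
  refine ⟨fun i => smul_ne_zero (hr' i) (by simp), fun i j hij => ?_, ?_⟩
  · rw [inner_smul_left, inner_smul_right, EuclideanSpace.inner_single_left]
    simp [hij]
  · rw [closedSpan_eq_span, eq_top_iff]
    rintro z -
    have hz : z = ∑ i, (z i * (r i : 𝕜)⁻¹) • (r i : 𝕜) •
        (EuclideanSpace.single i 1 : EuclideanSpace 𝕜 σ) := by
      have := (EuclideanSpace.basisFun σ 𝕜).sum_repr z
      conv_lhs => rw [← this]
      refine Finset.sum_congr rfl fun i _ => ?_
      rw [smul_smul, mul_assoc, inv_mul_cancel₀ (hr' i), mul_one]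
      simp
    rw [hz]
    exact Submodule.sum_mem _ fun i _ => Submodule.smul_mem _ _ (Submodule.subset_span ⟨i, rfl⟩)

theorem sum_smul_smul_single_apply {𝕜 σ : Type*} [RCLike 𝕜] [Fintype σ] [DecidableEq σ]
    (c r : σ → 𝕜) (k : σ) :
    (∑ i, c i • r i • (EuclideanSpace.single i 1 : EuclideanSpace 𝕜 σ)) k = c k * r k := by
  rw [WithLp.ofLp_sum, Finset.sum_apply, Finset.sum_eq_single k]
  · simp
  · intro i _ hik
    simp [hik.symm]
  · simp

theorem theorem2p1 :
    ∃ h : ℝ → ℝ, (∀ ε : ℝ, 0 < ε → 0 < h ε) ∧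
      ∀ (𝕜 : Type*) [RCLike 𝕜] (H : Type*) [NormedAddCommGroup H] [InnerProductSpace 𝕜 H]
        (n : ℕ), 0 < n → Module.finrank 𝕜 H = n →
      ∀ (ι : Type*) (x : ι → H) (c : ℝ), IsFrameWithConstant 𝕜 x c →
      ∀ ε : ℝ, 0 < ε →
        ∃ σ : Finset ι, (1 - ε) * (n : ℝ) < (σ.card : ℝ) ∧
          ∃ y : σ → EuclideanSpace 𝕜 σ, IsOrthogonalBasis 𝕜 y ∧
            IsEquivalentWith 𝕜 (h ε * c) (fun j : σ => x j) y := by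
  classical
  -- Truncating at `1` reduces large `ε` to the range in which the selection is proved.
  refine ⟨fun ε => √(rieszUpper (min ε 1) / rieszLower (min ε 1)), fun ε hε =>
    Real.sqrt_pos.2 (div_pos (rieszUpper_pos _) (rieszLower_pos (lt_min hε one_pos))), ?_⟩
  intro 𝕜 _ H _ _ n hn hH ι x c hc ε hε
  obtain ⟨A, B, hAB, rfl⟩ := hc
  obtain ⟨L, hpars, hL⟩ := hAB.exists_whitening hn hH
  obtain ⟨hA, hB, -⟩ := hAB
  have hε' : 0 < min ε 1 := lt_min hε one_pos
  obtain ⟨κ, _, j, hcard, hj0, hj⟩ := hpars.exists_riesz hn hε' (min_le_right _ _)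
  have hlo := rieszLower_pos hε'
  have hup := rieszUpper_pos (min ε 1)
  set lo := rieszLower (min ε 1)
  set up := rieszUpper (min ε 1)
  have hinj : Function.Injective j :=
    injective_of_riesz hlo (w := fun i => unitize 𝕜 (L (x i))) fun c => (hj c).1
  set σ : Finset ι := Finset.univ.map ⟨j, hinj⟩ with hσ
  let e : κ ≃ σ := Equiv.ofBijective (fun a => ⟨j a, by simp [hσ]⟩)
    ⟨fun a a' h => hinj (congrArg Subtype.val h), fun i => by
      obtain ⟨a, -, ha⟩ := Finset.mem_map.1 i.2
      exact ⟨a, Subtype.ext ha⟩⟩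
  have he : ∀ a, ((e a : σ) : ι) = j a := fun a => rfl
  have hr : ∀ i : σ, ‖L (x i)‖ ≠ 0 := fun i => by
    obtain ⟨a, rfl⟩ := e.surjective i
    rw [he]; exact norm_ne_zero_iff.2 (hj0 a)
  -- The lengths `‖L (x i)‖` restore what `unitize` removed: coefficients `c i` on `x` become `c i *
  -- ‖L (x i)‖` on the unit vectors, so Riesz bounds compare `L (∑ c i • x i)` with `∑ c i • y i`.
  set y : σ → EuclideanSpace 𝕜 σ := fun i => ((‖L (x i)‖ : ℝ) : 𝕜) • EuclideanSpace.single i 1 with hy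
  have hbasis : IsOrthogonalBasis 𝕜 y := isOrthogonalBasis_smul_single hr
  have hyn : ∀ c : σ → 𝕜, ‖∑ i, c i • y i‖ ^ 2 = ∑ a, ‖c (e a) * (‖L (x (j a))‖ : 𝕜)‖ ^ 2 :=
    fun c => by
      rw [EuclideanSpace.norm_sq_eq, ← e.sum_comp]
      refine Finset.sum_congr rfl fun a _ => ?_
      rw [hy, sum_smul_smul_single_apply, he]
  have hLn : ∀ c : σ → 𝕜, L (∑ i, c i • x i) =
      ∑ a, (c (e a) * (‖L (x (j a))‖ : 𝕜)) • unitize 𝕜 (L (x (j a))) := fun c => by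
    rw [map_sum, ← e.sum_comp]
    refine Finset.sum_congr rfl fun a _ => ?_
    have : ((‖L (x (j a))‖ : ℝ) : 𝕜) ≠ 0 := by
      rw [Ne, RCLike.ofReal_eq_zero]; exact norm_ne_zero_iff.2 (hj0 a)
    rw [map_smul, he, unitize, smul_smul, mul_assoc, mul_inv_cancel₀ this, mul_one]
  refine ⟨σ, ?_, y, hbasis, ?_⟩
  · rw [hσ, Finset.card_map, Finset.card_univ]
    refine lt_of_le_of_lt ?_ hcard
    have := min_le_left ε 1
    gcongr
  -- The Riesz bounds `lo`, `up` and the whitening bounds `A`, `B` multiply to `√(B up / (A lo))`,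
  -- which is `h ε * c`.
  · rw [← Real.sqrt_mul (by positivity), div_mul_div_comm, mul_comm up, mul_comm lo]
    refine isEquivalentWith_of_norm_sq ?_ (mul_pos hA hlo) (mul_pos hB hup).le ?_ ?_
    · exact linearIndependent_of_ne_zero_of_inner_eq_zero hbasis.1 fun i j hij => hbasis.2.1 i j hij
    · intro c
      have h1 := (hj fun a => c (e a) * (‖L (x (j a))‖ : 𝕜)).1
      rw [← hLn, ← hyn] at h1
      have h2 := (hL (∑ i : σ, c i • x i)).1
      calc _ = A * (lo * ‖∑ i, c i • y i‖ ^ 2) := by ring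
        _ ≤ A * ‖L (∑ i : σ, c i • x i)‖ ^ 2 := by gcongr
        _ ≤ _ := h2
    · intro c
      have h1 := (hj fun a => c (e a) * (‖L (x (j a))‖ : 𝕜)).2
      rw [← hLn, ← hyn] at h1
      have h2 := (hL (∑ i : σ, c i • x i)).2
      calc _ ≤ B * ‖L (∑ i : σ, c i • x i)‖ ^ 2 := h2
        _ ≤ B * (up * ‖∑ i, c i • y i‖ ^ 2) := by gcongr
        _ = _ := by ring
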